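/- Let $(A,\mathfrak m)$ be a Noetherian local ring, $M$ a finitely generated $A$-module that is formally equidimensional (i.e. the $\mathfrak m$-adic completion $\widehat M$ satisfies $\dim \widehat M/\mathfrak p\widehat M=\dim\widehat M$ for every minimal prime $\mathfrak p$ of the $\widehat A$-module $\widehat M$), and let $I\subsetneq A$ be a proper ideal with $\dim M/IM<\dim M$. Put $G_I(A)=\bigoplus_{n\ge 0}I^n/I^{n+1}$ and $G_I(M)=\bigoplus_{n\ge0}I^nM/I^{n+1}M$. For $a\in I^n\setminus I^{n+1}$ let $a^*$ be the class of $a$ in $I^n/I^{n+1}$; an element of $G_I(A)$ is called part of a system of parameters of $G_I(M)$ if its image is part of a system of parameters of the localization of $G_I(M)$ at the homogeneous maximal ideal $\mathfrak m/I\oplus I/I^2\oplus I^2/I^3\oplus\cdots$ of $G_I(A)$. The first coefficient ideal of $(I,M)$ is $$I_{\{1\}}^M=\bigcup\,(I^{n+1}M:_A aM),$$ the union being over all $n\ge1$ and all $a\in I^n\setminus I^{n+1}$ such that $a^*$ is part of a system of parameters of $G_I(M)$. Then: 1. There are an integer $m\ge1$ and an element $x\in I^m\setminus I^{m+1}$,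 with $x^*$ part of a system of parameters of $G_I(M)$, such that $I_{\{1\}}^M=(I^{m+1}M:_A xM)$ (in particular, the union $I_{\{1\}}^M$ is an ideal of $A$). 2. $\dim G_I(M)=\dim M$, and for every ideal $J\supseteq I$ of $A$ one has $J\subseteq I_{\{1\}}^M$ if and only if $\dim_{G_I(A)}\bigoplus_{n\ge0}JI^nM/I^{n+1}M<\dim M$. -/

import Mathlib

universe u v

noncomputable section

/-! ### Equidimensional and formally equidimensional modules -/

/-- A module is equidimensional if `dim M / pM = dim M` for every minimal prime `p` of `M`
(intended for finitely generated modules, where the minimal primes of `M` are the minimal primes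
over the annihilator). -/
def IsEquidimensionalModule (R : Type u) [CommRing R] (M : Type v) [AddCommGroup M] [Module R M] :
    Prop :=
  ∀ p ∈ (Module.annihilator R M).minimalPrimes,
    Module.supportDim R (M ⧸ (p • ⊤ : Submodule R M)) = Module.supportDim R M

/-- A module over a local ring is formally equidimensional if its completion with respect to the
maximal ideal is equidimensional over the completed ring. -/
def IsFormallyEquidimensionalModule (A : Type u) [CommRing A] [IsLocalRing A]
    (M : Type v) [AddCommGroup M] [Module A M] : Prop :=
  IsEquidimensionalModule (AdicCompletion (IsLocalRing.maximalIdeal A) A)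
    (AdicCompletion (IsLocalRing.maximalIdeal A) M)

/-! ### Systems of parameters -/

/-- `x₁, …, x_d` is a system of parameters of the (finitely generated) module `N` over the local
ring `R`: the `xᵢ` lie in the maximal ideal, `d = dim N`, and `N / (x₁, …, x_d) N` has finite
length. -/
def IsSystemOfParameters (R : Type u) [CommRing R] [IsLocalRing R] (N : Type v) [AddCommGroup N]
    [Module R N] {d : ℕ} (x : Fin d → R) : Prop :=
  (∀ i, x i ∈ IsLocalRing.maximalIdeal R) ∧ Module.supportDim R N = d ∧
    IsFiniteLength R (N ⧸ (Ideal.span (Set.range x) • ⊤ : Submodule R N))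

/-- `a` is part of a system of parameters of the module `N` over the local ring `R`. -/
def IsPartOfSystemOfParameters (R : Type u) [CommRing R] [IsLocalRing R] (N : Type v)
    [AddCommGroup N] [Module R N] (a : R) : Prop :=
  ∃ (d : ℕ) (x : Fin d → R), IsSystemOfParameters R N x ∧ ∃ i, x i = a

/-- `a ∈ R` is part of a system of parameters of the `R`-module `N` at the prime `P`: its image in
`R_P` is part of a system of parameters of `N_P`. -/
def IsPartOfSystemOfParametersAt {R : Type u} [CommRing R] (P : Ideal R) [P.IsPrime] (N : Type v)
    [AddCommGroup N] [Module R N] (a : R) : Prop :=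
  IsPartOfSystemOfParameters (Localization.AtPrime P) (LocalizedModule P.primeCompl N)
    (algebraMap R (Localization.AtPrime P) a)

/-! ### The associated graded ring and module -/

/-- The quotient `N / K N` of a module `N` by an ideal `K`, a module over `R / K`. -/
abbrev QuotientByIdeal (R : Type u) [CommRing R] (N : Type v) [AddCommGroup N] [Module R N]
    (K : Ideal R) : Type v :=
  N ⧸ (K • ⊤ : Submodule R N)

/-- The projection `N → N / K N`. -/
def QuotientByIdeal.mk (R : Type u) [CommRing R] (N : Type v) [AddCommGroup N] [Module R N]
    (K : Ideal R) : N →ₗ[R] QuotientByIdeal R N K :=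
  (K • ⊤ : Submodule R N).mkQ

section AssocGraded

variable {A : Type u} [CommRing A] (I : Ideal A) (M : Type v) [AddCommGroup M] [Module A M]

/-- The associated graded ring `G_I(A) = ⨁ Iⁿ / Iⁿ⁺¹`, as the quotient of the Rees algebra
`⨁ Iⁿ Xⁿ ⊆ A[X]` by the ideal `⨁ Iⁿ⁺¹ Xⁿ` generated by `I` in degree zero. -/
def AssocGradedRing : Type u :=
  reesAlgebra I ⧸ I.map (algebraMap A (reesAlgebra I))

instance AssocGradedRing.instCommRing : CommRing (AssocGradedRing I) :=
  inferInstanceAs (CommRing (reesAlgebra I ⧸ I.map (algebraMap A (reesAlgebra I))))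

/-- The Rees module `⨁ Iⁿ M Xⁿ ⊆ M[X]`. -/
abbrev ReesModule : Submodule (reesAlgebra I) (PolynomialModule A M) :=
  (I.stableFiltration (⊤ : Submodule A M)).submodule

/-- The associated graded module `G_I(M) = ⨁ Iⁿ M / Iⁿ⁺¹ M` over `G_I(A)`, as the quotient of the
Rees module `⨁ Iⁿ M Xⁿ` by `I · ⨁ Iⁿ M Xⁿ = ⨁ Iⁿ⁺¹ M Xⁿ`. -/
def AssocGradedModule : Type v :=
  QuotientByIdeal (reesAlgebra I) (ReesModule I M) (I.map (algebraMap A (reesAlgebra I)))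

instance AssocGradedModule.instAddCommGroup : AddCommGroup (AssocGradedModule I M) :=
  inferInstanceAs (AddCommGroup
    (QuotientByIdeal (reesAlgebra I) (ReesModule I M) (I.map (algebraMap A (reesAlgebra I)))))

instance AssocGradedModule.instModule : Module (AssocGradedRing I) (AssocGradedModule I M) :=
  inferInstanceAs (Module (reesAlgebra I ⧸ I.map (algebraMap A (reesAlgebra I)))
    (QuotientByIdeal (reesAlgebra I) (ReesModule I M) (I.map (algebraMap A (reesAlgebra I)))))

variable {M} in
/-- The class of `z ∈ Iⁿ M` in the degree `n` component `Iⁿ M / Iⁿ⁺¹ M` of `G_I(M)`. -/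
def AssocGradedModule.of (n : ℕ) (z : M) (hz : z ∈ (I ^ n • ⊤ : Submodule A M)) :
    AssocGradedModule I M :=
  QuotientByIdeal.mk (reesAlgebra I) (ReesModule I M) (I.map (algebraMap A (reesAlgebra I))) ⟨PolynomialModule.single A n z, by
    intro j
    rw [PolynomialModule.coeff_single, Finsupp.single_apply]
    split_ifs with h
    · exact h ▸ hz
    · exact Submodule.zero_mem _⟩

/-- The class of `a ∈ Iⁿ` in the degree `n` component `Iⁿ / Iⁿ⁺¹` of `G_I(A)`. For
`a ∈ Iⁿ \ Iⁿ⁺¹` this is the initial form `a*`. -/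
def AssocGradedRing.of (n : ℕ) (a : A) (ha : a ∈ I ^ n) : AssocGradedRing I :=
  Ideal.Quotient.mk (I.map (algebraMap A (reesAlgebra I))) ⟨Polynomial.monomial n a, reesAlgebra.monomial_mem.mpr ha⟩

/-- The projection of `G_I(A)` onto its degree zero component `A / I`. -/
def AssocGradedRing.degreeZero : AssocGradedRing I →+* A ⧸ I :=
  Ideal.Quotient.lift (I.map (algebraMap A (reesAlgebra I)))
    ((Ideal.Quotient.mk I).comp (Polynomial.constantCoeff.comp (reesAlgebra I).val.toRingHom)) (by
      intro f hf
      refine (Ideal.map_le_iff_le_comap (K := RingHom.ker ((Ideal.Quotient.mk I).comp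
        (Polynomial.constantCoeff.comp (reesAlgebra I).val.toRingHom)))).mpr ?_ hf
      intro a ha
      simpa [Ideal.mem_comap, RingHom.mem_ker, Ideal.Quotient.eq_zero_iff_mem] using ha)

/-- For a proper ideal `I` of a local ring `(A, 𝔪)`, the homogeneous maximal ideal
`𝔪/I ⊕ I/I² ⊕ I²/I³ ⊕ ⋯` of `G_I(A)`. -/
def AssocGradedRing.homogeneousMaximalIdeal [IsLocalRing A] : Ideal (AssocGradedRing I) :=
  ((IsLocalRing.maximalIdeal A).map (Ideal.Quotient.mk I)).comap (AssocGradedRing.degreeZero I)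

/-- An element `g` of `G_I(A)` is part of a system of parameters of `G_I(M)` if its image is part
of a system of parameters of the localization of `G_I(M)` at the homogeneous maximal ideal of
`G_I(A)`. (That ideal is prime as soon as `I` is proper, see
`AssocGradedRing.isPrime_homogeneousMaximalIdeal`.) -/
def IsPartOfSystemOfParametersGraded [IsLocalRing A] (g : AssocGradedRing I) : Prop :=
  ∃ _ : (AssocGradedRing.homogeneousMaximalIdeal I).IsPrime,
    IsPartOfSystemOfParametersAt (AssocGradedRing.homogeneousMaximalIdeal I) (AssocGradedModule I M) g

theorem AssocGradedRing.isPrime_homogeneousMaximalIdeal [IsLocalRing A] (hI : I ≠ ⊤) :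
    (AssocGradedRing.homogeneousMaximalIdeal I).IsPrime := by
  have hle : I ≤ IsLocalRing.maximalIdeal A := IsLocalRing.le_maximalIdeal hI
  have : ((IsLocalRing.maximalIdeal A).map (Ideal.Quotient.mk I)).IsPrime :=
    Ideal.map_isPrime_of_surjective Ideal.Quotient.mk_surjective (by simpa using hle)
  exact Ideal.comap_isPrime _ _

/-- The graded submodule `⨁ J Iⁿ M / Iⁿ⁺¹ M` of `G_I(M)`, where `I ⊆ J`: the submodule generated by
the classes of all elements of `J Iⁿ M` in degree `n`, for all `n`. -/
def gradedSubmoduleOfIdeal (J : Ideal A) : Submodule (AssocGradedRing I) (AssocGradedModule I M) :=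
  Submodule.span (AssocGradedRing I)
    {g | ∃ (n : ℕ) (z : M) (hz : z ∈ (I ^ n • ⊤ : Submodule A M)),
      z ∈ J • (I ^ n • ⊤ : Submodule A M) ∧ g = AssocGradedModule.of I n z hz}

/-- The first coefficient ideal of `(I, M)`: the union of the ideals `(Iⁿ⁺¹ M :_A a M)` over all
`n ≥ 1` and all `a ∈ Iⁿ \ Iⁿ⁺¹` such that `a*` is part of a system of parameters of `G_I(M)`.
It is defined here as the set which is this union. -/
def firstCoefficientIdeal [IsLocalRing A] : Set A :=
  {r | ∃ (n : ℕ) (a : A) (ha : a ∈ I ^ n), 1 ≤ n ∧ a ∉ I ^ (n + 1) ∧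
    IsPartOfSystemOfParametersGraded I M (AssocGradedRing.of I n a ha) ∧
    r ∈ (I ^ (n + 1) • ⊤ : Submodule A M).colon
      ((Ideal.span {a} • ⊤ : Submodule A M) : Set M)}

end AssocGraded

end

/-! Work in the Rees algebra `R = A[It]`, of which `G_I(A)` is a quotient, and put `d = dim M`. For
an ideal `J` of `A` let `𝔞(J)` be the homogeneous ideal of all `f` with `fₙ J M ⊆ Iⁿ⁺¹ M` for every
`n`. It is the preimage in `R` of the annihilator of `⨁ J Iⁿ M / Iⁿ⁺¹ M`, and `𝔞(A)` is the preimage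
of the annihilator of `G_I(M)`.

The dimension of `G_I(M)` is `d`. The upper bound comes from `dim D[It] ≤ dim D + 1` for a
Noetherian domain `D`; the lower bound comes from lifting a chain of primes to the extended Rees
algebra `A[It, t⁻¹]` and cutting by `t⁻¹`. Hence the top primes, those `Q ⊇ 𝔞(A)` that start a chain
of length `d`, are minimal over `𝔞(A)`. So they are finitely many, pairwise incomparable and
homogeneous; since `dim M/IM < d`, none contains all elements of positive degree.

Two properties are then tested on the top primes. For `n ≥ 1` the class of `a ∈ Iⁿ` is part of a
system of parameters if and only if `a tⁿ` avoids every top prime. The dimension of `⨁ J Iⁿ M / Iⁿ⁺¹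
M` is less than `d` if and only if no top prime contains `𝔞(J)`. The first is defined in a
localization, so chains of primes have to be moved below the homogeneous maximal ideal. This rests
on the fact that passing to homogeneous cores costs at most one step of a chain.

Since `𝔞(J) ∩ 𝔞(J') ⊆ 𝔞(J + J')`, there is a greatest ideal `J₀` with `𝔞(J₀)` in no top prime.
Moreover `a tⁿ ∈ 𝔞(J)` means `J ⊆ (Iⁿ⁺¹ M : aM)`. So every colon ideal in the union lies in `J₀`,
while homogeneous prime avoidance gives `x tᵐ ∈ 𝔞(J₀)` outside all top primes, and its colon ideal
contains `J₀`. Therefore the union is `J₀ = (Iᵐ⁺¹ M : xM)`, and both claims follow.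

Dimensions are handled through `HasPrimeChain`, which remembers a prime at the top of the chain and
so survives localization and contraction. -/

open IsLocalRing

noncomputable section

/-! ### Chains of prime ideals -/

section PrimeChain

variable {R S : Type*} [CommRing R] [CommRing S]

/-- There is a chain of `n + 1` prime ideals, all containing `Q` and contained in `p`. -/
def HasPrimeChain (Q : Ideal R) (n : ℕ) (p : PrimeSpectrum R) : Prop :=
  ∃ l : LTSeries (PrimeSpectrum R), l.length = n ∧ Q ≤ l.head.asIdeal ∧ l.last ≤ p

namespace HasPrimeChain

theorem zero_iff {Q : Ideal R} {p : PrimeSpectrum R} : HasPrimeChain Q 0 p ↔ Q ≤ p.asIdeal := by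
  constructor
  · rintro ⟨l, hl, h1, h2⟩
    exact h1.trans (((LTSeries.monotone l) (Fin.zero_le _)).trans h2 : l.head ≤ p)
  · intro h
    exact ⟨RelSeries.singleton _ p, rfl, h, le_rfl⟩

theorem succ_iff {Q : Ideal R} {n : ℕ} {p : PrimeSpectrum R} :
    HasPrimeChain Q (n + 1) p ↔ ∃ q < p, HasPrimeChain Q n q := by
  constructor
  · rintro ⟨l, hl, h1, h2⟩
    refine ⟨l.eraseLast.last, ?_, l.eraseLast, by simp [hl], h1, le_rfl⟩
    exact lt_of_lt_of_le (RelSeries.eraseLast_last_rel_last l (by omega)) h2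
  · rintro ⟨q, hq, l, hl, h1, h2⟩
    exact ⟨l.snoc p (lt_of_le_of_lt h2 hq), by simp [hl], by simpa using h1, by simp⟩

theorem mono {Q Q' : Ideal R} {n : ℕ} {p p' : PrimeSpectrum R} (h : HasPrimeChain Q n p)
    (hQ : Q' ≤ Q) (hp : p ≤ p') : HasPrimeChain Q' n p' := by
  obtain ⟨l, hl, h1, h2⟩ := h
  exact ⟨l, hl, hQ.trans h1, h2.trans hp⟩

theorem le {Q : Ideal R} {n : ℕ} {p : PrimeSpectrum R} (h : HasPrimeChain Q n p) :
    Q ≤ p.asIdeal := by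
  obtain ⟨l, hl, h1, h2⟩ := h
  exact h1.trans (((LTSeries.monotone l) (Fin.zero_le _)).trans h2 : l.head ≤ p)

theorem exists_prime {Q : Ideal R} {n : ℕ} {p : PrimeSpectrum R} (h : HasPrimeChain Q n p) :
    ∃ P : PrimeSpectrum R, Q ≤ P.asIdeal ∧ HasPrimeChain P.asIdeal n p := by
  obtain ⟨l, hl, h1, h2⟩ := h
  exact ⟨l.head, h1, l, hl, le_rfl, h2⟩

theorem cons {P : PrimeSpectrum R} {Q : Ideal R} {n : ℕ} {p : PrimeSpectrum R}
    (h : HasPrimeChain Q n p) (hP : P.asIdeal < Q) : HasPrimeChain P.asIdeal (n + 1) p := by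
  obtain ⟨l, hl, h1, h2⟩ := h
  exact ⟨l.cons P (lt_of_lt_of_le hP h1 : P.asIdeal < l.head.asIdeal), by simp [hl],
    by simp, by simpa using h2⟩

theorem le_ringKrullDim {Q : Ideal R} {n : ℕ} {p : PrimeSpectrum R} (h : HasPrimeChain Q n p) :
    (n : WithBot ℕ∞) ≤ ringKrullDim (R ⧸ Q) := by
  obtain ⟨l, hl, h1, h2⟩ := h
  rw [ringKrullDim_quotient]
  refine Order.le_krullDim_iff.mpr
    ⟨⟨l.length, fun i => ⟨l i, h1.trans (l.monotone (Fin.zero_le i))⟩, fun i => l.step i⟩, hl⟩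

theorem of_le_ringKrullDim {Q : Ideal R} {n : ℕ} (h : (n : WithBot ℕ∞) ≤ ringKrullDim (R ⧸ Q)) :
    ∃ p, HasPrimeChain Q n p := by
  rw [ringKrullDim_quotient] at h
  obtain ⟨l, hl⟩ := Order.le_krullDim_iff.mp h
  exact ⟨l.last.1, l.map Subtype.val (fun _ _ h => h), hl, l.head.2, le_rfl⟩

theorem comap (f : R →+* S) {Q : Ideal S}
    (hf : ∀ q q' : PrimeSpectrum S, Q ≤ q.asIdeal → q < q' →
      PrimeSpectrum.comap f q < PrimeSpectrum.comap f q') {n : ℕ} {p : PrimeSpectrum S}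
    (h : HasPrimeChain Q n p) : HasPrimeChain (Q.comap f) n (PrimeSpectrum.comap f p) := by
  induction n generalizing p with
  | zero => exact zero_iff.mpr (Ideal.comap_mono (zero_iff.mp h))
  | succ n ih =>
    obtain ⟨q, hq, h⟩ := succ_iff.mp h
    exact succ_iff.mpr ⟨_, hf q p h.le hq, ih h⟩

theorem of_comap (f : R →+* S) {Q : Ideal R} {Q' : Ideal S} {N : PrimeSpectrum R}
    (hf : ∀ q q' : PrimeSpectrum S, PrimeSpectrum.comap f q ≤ PrimeSpectrum.comap f q' → q ≤ q')
    (hs : ∀ q : PrimeSpectrum R, Q ≤ q.asIdeal → q ≤ N → ∃ q', PrimeSpectrum.comap f q' = q)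
    (hQ : ∀ q : PrimeSpectrum S, Q ≤ q.asIdeal.comap f → Q' ≤ q.asIdeal)
    {n : ℕ} {p : PrimeSpectrum S} (hp : PrimeSpectrum.comap f p ≤ N)
    (h : HasPrimeChain Q n (PrimeSpectrum.comap f p)) : HasPrimeChain Q' n p := by
  induction n generalizing p with
  | zero => exact zero_iff.mpr (hQ _ (zero_iff.mp h))
  | succ n ih =>
    obtain ⟨q, hq, h⟩ := succ_iff.mp h
    obtain ⟨q', rfl⟩ := hs q h.le (hq.le.trans hp)
    refine succ_iff.mpr ⟨q', lt_of_le_not_ge (hf _ _ hq.le) fun hle => ?_, ih (hq.le.trans hp) h⟩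
    exact hq.not_ge (Ideal.comap_mono hle)

theorem le_of_ringKrullDim_le {Q : Ideal R} {n d : ℕ} {p : PrimeSpectrum R}
    (h : HasPrimeChain Q n p) (hd : ringKrullDim (R ⧸ Q) ≤ d) : n ≤ d := by
  exact_mod_cast h.le_ringKrullDim.trans hd

theorem of_succ {Q : Ideal R} {n : ℕ} {p : PrimeSpectrum R} (h : HasPrimeChain Q (n + 1) p) :
    HasPrimeChain Q n p := by
  obtain ⟨q, hq, h⟩ := succ_iff.mp h
  exact h.mono le_rfl hq.le

theorem of_le {Q : Ideal R} {n m : ℕ} {p : PrimeSpectrum R} (h : HasPrimeChain Q m p)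
    (hnm : n ≤ m) : HasPrimeChain Q n p := by
  induction m, hnm using Nat.le_induction with
  | base => exact h
  | succ m _ ih => exact ih h.of_succ

end HasPrimeChain

theorem ringKrullDim_quotient_le_iff {Q : Ideal R} {d : ℕ} :
    ringKrullDim (R ⧸ Q) ≤ d ↔ ∀ n p, HasPrimeChain Q n p → n ≤ d := by
  refine ⟨fun h n p hp => hp.le_of_ringKrullDim_le h, fun h => ?_⟩
  rw [ringKrullDim_quotient]
  refine iSup_le fun l => Nat.cast_le.mpr ?_
  exact h _ l.last.1 ⟨l.map Subtype.val (fun _ _ h => h), rfl, l.head.2, le_rfl⟩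

/-- A chain of primes below a prime containing `y` can be pushed into the closed set `y = 0`
at the cost of one prime. -/
theorem HasPrimeChain.cut [IsNoetherianRing R] {Q : Ideal R} {n : ℕ} {p : PrimeSpectrum R}
    (h : HasPrimeChain Q (n + 1) p) {y : R} (hy : y ∈ p.asIdeal) :
    HasPrimeChain (Q ⊔ Ideal.span {y}) n p := by
  obtain ⟨q, hq, l, hl, h1, h2⟩ := HasPrimeChain.succ_iff.mp h
  obtain ⟨l', hy', hlen, hhead, hlast⟩ :=
    PrimeSpectrum.exist_ltSeries_mem_one_of_mem_last (l.snoc p (lt_of_le_of_lt h2 hq))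
      (x := y) (by simpa using hy)
  have hlen' : l'.length = n + 1 := by rw [← hlen]; simp [hl]
  -- The replaced chain has the same ends, and `y` lies in its second prime but perhaps not in its
  -- first. Dropping the first prime is the cost of the cut.
  refine ⟨l'.tail (by omega), by simp [hlen'], ?_, ?_⟩
  · rw [RelSeries.head_tail]
    refine sup_le ?_ ((Ideal.span_singleton_le_iff_mem _).mpr hy')
    have : l'.head ≤ l' 1 := l'.monotone (Fin.zero_le _)
    refine le_trans ?_ (show l'.head.asIdeal ≤ _ from this)
    rw [← hhead]
    simpa using h1
  · rw [RelSeries.last_tail, ← hlast]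
    simp

theorem HasPrimeChain.cut_finset [IsNoetherianRing R] {Q : Ideal R} {n : ℕ} {p : PrimeSpectrum R}
    (s : Finset R) (h : HasPrimeChain Q (n + s.card) p) (hs : (s : Set R) ⊆ p.asIdeal) :
    HasPrimeChain (Q ⊔ Ideal.span s) n p := by
  classical
  induction s using Finset.induction_on generalizing n with
  | empty => simpa using h
  | insert y s hy ih =>
    rw [Finset.card_insert_of_notMem hy, ← add_assoc, add_right_comm] at h
    rw [Finset.coe_insert, Set.insert_subset_iff] at hs
    have := (ih h hs.2).cut hs.1
    rwa [sup_assoc, sup_comm (Ideal.span _) (Ideal.span _), ← Ideal.span_union,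
      Set.singleton_union, ← Finset.coe_insert] at this

end PrimeChain

/-! ### Modules of finite length and systems of parameters -/

section SystemOfParameters

variable {L : Type*} [CommRing L] [IsNoetherianRing L] {V : Type*} [AddCommGroup V] [Module L V]
  [Module.Finite L V]

theorem isFiniteLength_of_support_isMaximal
    (h : ∀ P ∈ Module.support L V, P.asIdeal.IsMaximal) : IsFiniteLength L V := by
  rw [isFiniteLength_iff_isNoetherian_isArtinian]
  refine ⟨inferInstance, ?_⟩
  have : Ring.KrullDimLE 0 (L ⧸ Module.annihilator L V) := by
    refine Ring.KrullDimLE.mk₀ fun P hP => ?_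
    have := h ⟨P.comap (Ideal.Quotient.mk _), inferInstance⟩ (by
      rw [Module.mem_support_iff_of_finite]
      intro x hx
      simp [Ideal.mem_comap, Ideal.Quotient.eq_zero_iff_mem.mpr hx])
    exact Ideal.isMaximal_of_isIntegral_of_isMaximal_comap (R := L) P this
  have hart : IsArtinianRing (L ⧸ Module.annihilator L V) :=
    isArtinianRing_iff_isNoetherianRing_krullDimLE_zero.mpr ⟨inferInstance, this⟩
  let _ : Module (L ⧸ Module.annihilator L V) V := Module.quotientAnnihilator
  have : IsScalarTower L (L ⧸ Module.annihilator L V) V := Module.IsTorsionBySet.isScalarTower _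
  have : Module.Finite (L ⧸ Module.annihilator L V) V :=
    Module.Finite.of_restrictScalars_finite L _ _
  exact isArtinian_of_surjective_algebraMap (R := L ⧸ Module.annihilator L V)
    Ideal.Quotient.mk_surjective

-- Acting on finitely many generators embeds `L / Ann V` into a power of `V`. So `L / P` is an
-- Artinian domain, that is, a field.
omit [IsNoetherianRing L] in
theorem IsFiniteLength.isMaximal_of_annihilator_le (h : IsFiniteLength L V) {P : Ideal L}
    [P.IsPrime] (hP : Module.annihilator L V ≤ P) : P.IsMaximal := by
  obtain ⟨-, hart⟩ := isFiniteLength_iff_isNoetherian_isArtinian.mp h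
  obtain ⟨s, hs⟩ := Module.Finite.fg_top (R := L) (M := V)
  let φ : L →ₗ[L] (s → V) := LinearMap.pi fun w => LinearMap.toSpanSingleton L V w
  have hker : LinearMap.ker φ ≤ P := by
    refine le_trans (fun r hr => ?_) hP
    rw [Module.mem_annihilator]
    intro m
    have : m ∈ Submodule.span L (s : Set V) := hs ▸ Submodule.mem_top
    induction this using Submodule.span_induction with
    | mem x hx => exact congrFun (LinearMap.mem_ker.mp hr) ⟨x, hx⟩
    | zero => simp
    | add x y _ _ hx hy => rw [smul_add, hx, hy, add_zero]
    | smul a x _ hx => rw [smul_comm, hx, smul_zero]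
  have h1 : IsArtinian L (L ⧸ LinearMap.ker φ) :=
    isArtinian_of_linearEquiv φ.quotKerEquivRange.symm
  have h2 : IsArtinian L (L ⧸ P) :=
    isArtinian_of_surjective _ (Submodule.factor hker) (Submodule.factor_surjective hker)
  have h3 : IsArtinianRing (L ⧸ P) := isArtinian_of_tower L h2
  rw [← Ideal.bot_quotient_isMaximal_iff]
  exact Ideal.IsPrime.isMaximal' inferInstance

omit [IsNoetherianRing L] in
theorem exists_mem_support_of_hasPrimeChain {n : ℕ} {p : PrimeSpectrum L}
    (h : HasPrimeChain (Module.annihilator L V) n p) :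
    ∃ P ∈ Module.support L V, HasPrimeChain P.asIdeal n p := by
  obtain ⟨P, hP, h⟩ := h.exists_prime
  exact ⟨P, Module.mem_support_iff_of_finite.mpr hP, h⟩

end SystemOfParameters

/-! ### Systems of parameters over a local ring -/

section LocalSystemOfParameters

variable {L : Type u} [CommRing L] [IsLocalRing L] [IsNoetherianRing L] {V : Type v}
  [AddCommGroup V] [Module L V] [Module.Finite L V]

omit [IsNoetherianRing L] in
theorem hasPrimeChain_closedPoint {Q : Ideal L} {n : ℕ}
    (h : (n : WithBot ℕ∞) ≤ ringKrullDim (L ⧸ Q)) : HasPrimeChain Q n (closedPoint L) := by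
  obtain ⟨p, hp⟩ := HasPrimeChain.of_le_ringKrullDim h
  exact hp.mono le_rfl (IsLocalRing.le_maximalIdeal p.2.ne_top)

/-- Every finitely generated module over a Noetherian local ring has a system of parameters. -/
theorem exists_isSystemOfParameters {d : ℕ} (hd : Module.supportDim L V = d) :
    ∃ x : Fin d → L, (∀ i, x i ∈ maximalIdeal L) ∧
      ∀ P ∈ Module.support L V, Set.range x ⊆ P.asIdeal → P.asIdeal.IsMaximal := by
  rw [Module.supportDim_eq_ringKrullDim_quotient_annihilator] at hd
  have : Nontrivial (L ⧸ Module.annihilator L V) := by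
    by_contra hc
    rw [not_nontrivial_iff_subsingleton] at hc
    rw [ringKrullDim_eq_bot_of_subsingleton] at hd
    exact WithBot.coe_ne_bot hd.symm
  have : IsLocalRing (L ⧸ Module.annihilator L V) :=
    IsLocalRing.of_surjective' _ Ideal.Quotient.mk_surjective
  have : IsLocalHom (Ideal.Quotient.mk (Module.annihilator L V)) :=
    IsLocalHom.of_surjective _ Ideal.Quotient.mk_surjective
  -- The maximal ideal of `L / Ann V` is minimal over as many elements as its height, which is `d`;
  -- these are lifted to `L`.
  obtain ⟨s, hs, hcard⟩ := Ideal.exists_finset_card_eq_height_of_isNoetherianRing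
    (maximalIdeal (L ⧸ Module.annihilator L V))
  have hcard' : s.card = d := by
    have := IsLocalRing.maximalIdeal_height_eq_ringKrullDim (R := L ⧸ Module.annihilator L V)
    rw [hd, ← hcard] at this
    exact_mod_cast this
  subst hcard'
  have hmem : ∀ y : s, ∃ x : L, Ideal.Quotient.mk (Module.annihilator L V) x = y :=
    fun y => Ideal.Quotient.mk_surjective _
  choose g hg using hmem
  refine ⟨fun i => g (s.equivFin.symm i), fun i => ?_, fun P hP hx => ?_⟩
  · have h1 : (s.equivFin.symm i : L ⧸ Module.annihilator L V) ∈ maximalIdeal _ :=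
      hs.1.2 (Ideal.subset_span (s.equivFin.symm i).2)
    rw [← hg] at h1
    rw [mem_maximalIdeal, mem_nonunits_iff] at h1 ⊢
    exact fun h => h1 (h.map _)
  · have hle := Module.mem_support_iff_of_finite.mp hP
    have hprime : (P.asIdeal.map (Ideal.Quotient.mk (Module.annihilator L V))).IsPrime :=
      Ideal.map_isPrime_of_surjective Ideal.Quotient.mk_surjective (by simpa using hle)
    have hsP : Ideal.span (s : Set (L ⧸ Module.annihilator L V)) ≤
        P.asIdeal.map (Ideal.Quotient.mk (Module.annihilator L V)) := by
      rw [Ideal.span_le]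
      intro y hy
      have := hx ⟨s.equivFin ⟨y, hy⟩, rfl⟩
      simp only [Equiv.symm_apply_apply] at this
      have h2 := Ideal.mem_map_of_mem (Ideal.Quotient.mk (Module.annihilator L V)) this
      rwa [hg] at h2
    have hmax := hs.2 ⟨hprime, hsP⟩ (le_maximalIdeal hprime.ne_top)
    have : P.asIdeal = maximalIdeal L := by
      refine le_antisymm (le_maximalIdeal P.2.ne_top) fun x hx => ?_
      have : Ideal.Quotient.mk (Module.annihilator L V) x ∈ maximalIdeal _ := by
        rw [mem_maximalIdeal, mem_nonunits_iff] at hx ⊢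
        exact fun h => hx ((isUnit_map_iff _ x).mp h)
      have := hmax this
      rwa [← Ideal.mem_comap, Ideal.comap_map_of_surjective' _ Ideal.Quotient.mk_surjective,
        Ideal.mk_ker, sup_eq_left.mpr hle] at this
    rw [this]
    infer_instance

/-- An element of the maximal ideal is part of a system of parameters if and only if it avoids
the primes of maximal dimension in the support. -/
theorem isPartOfSystemOfParameters_iff {d : ℕ} (hd : Module.supportDim L V = d) {a : L} :
    IsPartOfSystemOfParameters L V a ↔ a ∈ maximalIdeal L ∧
      ∀ P ∈ Module.support L V, HasPrimeChain P.asIdeal d (closedPoint L) → a ∉ P.asIdeal := by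
  classical
  constructor
  · rintro ⟨d', x, ⟨hx, hd', hfl⟩, i, rfl⟩
    obtain rfl : d' = d := by
      rw [hd] at hd'
      exact_mod_cast hd'.symm
    refine ⟨hx i, fun P hP hchain hiP => ?_⟩
    -- If `x i` were in `P`, cutting by the other at most `d' - 1` parameters would leave a chain of
    -- length one in the support of a module of finite length.
    have hcard : 1 + ((Finset.univ.erase i).image x).card ≤ d' := by
      have h1 := Finset.card_image_le (s := Finset.univ.erase i) (f := x)
      rw [Finset.card_erase_of_mem (Finset.mem_univ i), Finset.card_univ, Fintype.card_fin] at h1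
      have := i.pos
      omega
    have h1 := (hchain.of_le hcard).cut_finset _ (by
      intro y hy
      simp only [Finset.coe_image] at hy
      obtain ⟨j, -, rfl⟩ := hy
      exact hx j)
    obtain ⟨q, hq, h2⟩ := HasPrimeChain.succ_iff.mp h1
    have hle := HasPrimeChain.zero_iff.mp h2
    have hqs : q ∈ Module.support L (V ⧸ (Ideal.span (Set.range x) • ⊤ : Submodule L V)) := by
      rw [Module.support_quotient]
      refine ⟨Module.mem_support_mono (le_sup_left.trans hle) hP, ?_⟩
      rw [PrimeSpectrum.mem_zeroLocus, SetLike.coe_subset_coe, Ideal.span_le]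
      rintro _ ⟨j, rfl⟩
      by_cases hj : j = i
      · subst hj
        exact le_sup_left.trans hle hiP
      · exact le_sup_right.trans hle (Ideal.subset_span (by
          simp only [Finset.coe_image]
          exact ⟨j, by simp [hj], rfl⟩))
    have hmax := hfl.isMaximal_of_annihilator_le (Module.mem_support_iff_of_finite.mp hqs)
    exact hq.ne (PrimeSpectrum.ext (IsLocalRing.eq_maximalIdeal hmax))
  · rintro ⟨ham, havoid⟩
    have hd1 := hd
    rw [Module.supportDim_eq_ringKrullDim_quotient_annihilator] at hd1
    have hchain := hasPrimeChain_closedPoint hd1.ge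
    have hsupp : ∀ P, P ∈ Module.support L (V ⧸ (Ideal.span {a} • ⊤ : Submodule L V)) ↔
        P ∈ Module.support L V ∧ a ∈ P.asIdeal := by
      intro P
      rw [Module.support_quotient, Set.mem_inter_iff, PrimeSpectrum.mem_zeroLocus,
        SetLike.coe_subset_coe, Ideal.span_singleton_le_iff_mem]
    -- For `d = 0` the closed point itself lies in the support and starts a chain of length zero, so
    -- no element of the maximal ideal avoids all the primes in question.
    obtain _ | e := d
    · obtain ⟨P, hP, h1⟩ := exists_mem_support_of_hasPrimeChain hchain
      refine absurd ham (havoid (closedPoint L) (Module.mem_support_mono ?_ hP) ?_)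
      · exact le_maximalIdeal P.2.ne_top
      · exact HasPrimeChain.zero_iff.mpr le_rfl
    have hdim : Module.supportDim L (V ⧸ (Ideal.span {a} • ⊤ : Submodule L V)) = e := by
      rw [Module.supportDim_eq_ringKrullDim_quotient_annihilator]
      refine le_antisymm (ringKrullDim_quotient_le_iff.mpr fun n p hp => ?_) ?_
      · obtain ⟨P, hP, hp⟩ := exists_mem_support_of_hasPrimeChain hp
        rw [hsupp] at hP
        by_contra hn
        refine havoid P hP.1 ?_ hP.2
        exact hasPrimeChain_closedPoint ((hp.of_le (not_le.mp hn)).le_ringKrullDim)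
      · obtain ⟨P, hP, h⟩ := (hchain.cut ham).exists_prime
        refine (h.mono ?_ le_rfl).le_ringKrullDim
        refine Module.annihilator_le_of_mem_support ((hsupp P).mpr ⟨?_, ?_⟩)
        · exact Module.mem_support_iff_of_finite.mpr (le_sup_left.trans hP)
        · exact hP (Ideal.mem_sup_right (Ideal.mem_span_singleton_self a))
    obtain ⟨x, hxm, hx⟩ := exists_isSystemOfParameters hdim
    refine ⟨e + 1, Fin.cons a x, ⟨fun i => ?_, hd, ?_⟩, 0, rfl⟩
    · refine Fin.cases ?_ (fun j => ?_) i
      · exact ham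
      · exact hxm j
    · refine isFiniteLength_of_support_isMaximal fun P hP => ?_
      rw [Module.support_quotient, Set.mem_inter_iff, PrimeSpectrum.mem_zeroLocus,
        SetLike.coe_subset_coe, Ideal.span_le, Fin.range_cons, Set.insert_subset_iff] at hP
      exact hx P ((hsupp P).mpr ⟨hP.1, hP.2.1⟩) hP.2.2

end LocalSystemOfParameters

/-! ### Homogeneous ideals of graded rings -/

section Width

open Polynomial

variable {D : Type*} [CommRing D]

/-- One step of the division of Laurent polynomials: cancelling top coefficients lowers the
difference between the degree and the trailing degree. -/
theorem Polynomial.natDegree_sub_natTrailingDegree_lt {F G H : D[X]}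
    (hw : F.natDegree - F.natTrailingDegree ≤ G.natDegree - G.natTrailingDegree)
    (hH : H = C F.leadingCoeff * (X ^ F.natDegree * G) - C G.leadingCoeff * (X ^ G.natDegree * F))
    (hH0 : H ≠ 0) :
    H.natDegree - H.natTrailingDegree < G.natDegree - G.natTrailingDegree := by
  have htF := natTrailingDegree_le_natDegree F
  have htG := natTrailingDegree_le_natDegree G
  have hcoeff : ∀ m, H.coeff m = F.leadingCoeff * (if F.natDegree ≤ m then
      G.coeff (m - F.natDegree) else 0) - G.leadingCoeff * (if G.natDegree ≤ m then
      F.coeff (m - G.natDegree) else 0) := by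
    intro m
    rw [hH, coeff_sub, coeff_C_mul, coeff_C_mul, coeff_X_pow_mul', coeff_X_pow_mul']
  have h1 : H.natDegree ≤ F.natDegree + G.natDegree := by
    rw [natDegree_le_iff_coeff_eq_zero]
    intro m hm
    rw [hcoeff, coeff_eq_zero_of_natDegree_lt (by omega), coeff_eq_zero_of_natDegree_lt (by omega)]
    simp
  have h2 : H.natDegree ≠ F.natDegree + G.natDegree := by
    intro h
    refine leadingCoeff_ne_zero.mpr hH0 ?_
    rw [leadingCoeff, h, hcoeff, if_pos (by omega), if_pos (by omega), Nat.add_sub_cancel_left,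
      Nat.add_sub_cancel]
    simp only [coeff_natDegree]
    ring
  have h3 : F.natDegree + G.natTrailingDegree ≤ H.natTrailingDegree := by
    refine le_natTrailingDegree hH0 fun m hm => ?_
    rw [hcoeff]
    have e1 : (if F.natDegree ≤ m then G.coeff (m - F.natDegree) else 0) = 0 := by
      split_ifs with h
      · exact coeff_eq_zero_of_lt_natTrailingDegree (by omega)
      · rfl
    have e2 : (if G.natDegree ≤ m then F.coeff (m - G.natDegree) else 0) = 0 := by
      split_ifs with h
      · exact coeff_eq_zero_of_lt_natTrailingDegree (by omega)
      · rfl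
    rw [e1, e2]
    simp
  have := natTrailingDegree_le_natDegree H
  omega

end Width

/-- An `ℕ`-grading of a commutative ring, described by the ring homomorphism `f ↦ ∑ fₙ Xⁿ`. -/
structure GradingCoaction (R : Type*) [CommRing R] where
  /-- The homomorphism `f ↦ ∑ fₙ Xⁿ`. -/
  toHom : R →+* Polynomial R
  eval_one : ∀ f, (toHom f).eval 1 = f
  coeff_coeff : ∀ f m n,
    (toHom ((toHom f).coeff n)).coeff m = if m = n then (toHom f).coeff n else 0

namespace GradingCoaction

open Polynomial

variable {R : Type*} [CommRing R] (δ : GradingCoaction R)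

/-- The homogeneous component of degree `n`. -/
def component (n : ℕ) (f : R) : R := (δ.toHom f).coeff n

theorem coeff_toHom (f : R) (n : ℕ) : (δ.toHom f).coeff n = δ.component n f := rfl

theorem component_component (m n : ℕ) (f : R) :
    δ.component m (δ.component n f) = if m = n then δ.component n f else 0 :=
  δ.coeff_coeff f m n

theorem sum_component (f : R) : ∑ n ∈ (δ.toHom f).support, δ.component n f = f := by
  conv_rhs => rw [← δ.eval_one f, eval_eq_sum, sum_def]
  simp [component]

/-- The largest homogeneous ideal contained in `P`. -/
def homogeneousCore (P : Ideal R) : Ideal R :=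
  (P.map C).comap δ.toHom

theorem mem_homogeneousCore {P : Ideal R} {f : R} :
    f ∈ δ.homogeneousCore P ↔ ∀ n, δ.component n f ∈ P := by
  simp only [homogeneousCore, Ideal.mem_comap, Ideal.mem_map_C_iff, coeff_toHom]

/-- Primality is inherited from `P R[X]`, because the core is its contraction along a ring
homomorphism. -/
instance isPrime_homogeneousCore (P : Ideal R) [P.IsPrime] :
    (δ.homogeneousCore P).IsPrime :=
  have := Ideal.isPrime_map_C_of_isPrime (P := P)
  Ideal.comap_isPrime _ _

theorem homogeneousCore_le (P : Ideal R) : δ.homogeneousCore P ≤ P := by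
  intro f hf
  rw [← δ.sum_component f]
  exact Ideal.sum_mem _ fun n _ => δ.mem_homogeneousCore.mp hf n

/-- An ideal is homogeneous if it contains the components of its elements. -/
def IsHomogeneousIdeal (P : Ideal R) : Prop :=
  ∀ f ∈ P, ∀ n, δ.component n f ∈ P

variable {δ} in
theorem IsHomogeneousIdeal.le_homogeneousCore {P Q : Ideal R}
    (h : δ.IsHomogeneousIdeal Q) (hQP : Q ≤ P) : Q ≤ δ.homogeneousCore P :=
  fun f hf => δ.mem_homogeneousCore.mpr fun n => hQP (h f hf n)

theorem isHomogeneousIdeal_homogeneousCore (P : Ideal R) :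
    δ.IsHomogeneousIdeal (δ.homogeneousCore P) := by
  intro f hf n
  rw [δ.mem_homogeneousCore] at hf ⊢
  intro m
  rw [δ.component_component]
  split_ifs
  · exact hf n
  · exact P.zero_mem

theorem component_mem_homogeneousCore_iff {P : Ideal R} {n : ℕ}
    {f : R} : δ.component n f ∈ δ.homogeneousCore P ↔ δ.component n f ∈ P := by
  refine ⟨fun h => δ.homogeneousCore_le P h, fun h => δ.mem_homogeneousCore.mpr fun m => ?_⟩
  rw [δ.component_component]
  split_ifs
  · exact h
  · exact P.zero_mem

/-- The coaction modulo an ideal. -/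
def coactionMod (Q : Ideal R) : R →+* (R ⧸ Q)[X] :=
  (mapRingHom (Ideal.Quotient.mk Q)).comp δ.toHom

theorem coeff_coactionMod (Q : Ideal R) (f : R) (n : ℕ) :
    (δ.coactionMod Q f).coeff n = Ideal.Quotient.mk Q (δ.component n f) := by
  simp [coactionMod, coeff_toHom]

theorem coactionMod_eq_zero {Q P : Ideal R} (hP : δ.homogeneousCore P = Q)
    {f : R} : δ.coactionMod Q f = 0 ↔ f ∈ Q := by
  subst hP
  simp only [Polynomial.ext_iff, δ.coeff_coactionMod, coeff_zero, Ideal.Quotient.eq_zero_iff_mem,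
    δ.component_mem_homogeneousCore_iff]
  exact δ.mem_homogeneousCore.symm

theorem coactionMod_component (Q : Ideal R) (f : R) (n : ℕ) :
    δ.coactionMod Q (δ.component n f) = C ((δ.coactionMod Q f).coeff n) * X ^ n := by
  ext1 m
  rw [δ.coeff_coactionMod, δ.component_component, coeff_C_mul_X_pow, δ.coeff_coactionMod]
  split_ifs <;> simp

/-- The width of an element modulo a homogeneous ideal `Q`: the difference between the largest and
the smallest degree of a component not in `Q`. -/
def width (Q : Ideal R) (f : R) : ℕ :=
  (δ.coactionMod Q f).natDegree - (δ.coactionMod Q f).natTrailingDegree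

/-! ### Primes with a given homogeneous core -/

section

variable {Q q p : Ideal R}

/-- An element of width zero has a single component outside `Q`. That component would lie in `p`,
because all the others do, and so in the core `Q`. -/
theorem width_pos (hp : δ.homogeneousCore p = Q) {f : R} (hfp : f ∈ p) (hfQ : f ∉ Q) :
    0 < δ.width Q f := by
  rw [Nat.pos_iff_ne_zero]
  intro h
  have hQp : Q ≤ p := hp ▸ δ.homogeneousCore_le p
  set F := δ.coactionMod Q f with hF
  have hdeg : F.natDegree = F.natTrailingDegree :=
    le_antisymm (Nat.sub_eq_zero_iff_le.mp h) (natTrailingDegree_le_natDegree F)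
  have hzero : ∀ n, n ≠ F.natDegree → δ.component n f ∈ Q := by
    intro n hn
    rw [← Ideal.Quotient.eq_zero_iff_mem, ← δ.coeff_coactionMod, ← hF]
    rcases lt_or_gt_of_ne hn with h | h
    · exact coeff_eq_zero_of_lt_natTrailingDegree (hdeg ▸ h)
    · exact coeff_eq_zero_of_natDegree_lt h
  have hmem : δ.component F.natDegree f ∈ p := by
    by_cases hs : F.natDegree ∈ (δ.toHom f).support
    · have h1 := δ.sum_component f
      rw [← Finset.add_sum_erase _ _ hs] at h1
      rw [← h1] at hfp
      refine (Ideal.add_mem_iff_left p ?_).mp hfp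
      exact Ideal.sum_mem _ fun n hn => hQp (hzero n (Finset.ne_of_mem_erase hn))
    · have : δ.component F.natDegree f = 0 := notMem_support_iff.mp hs
      rw [this]
      exact p.zero_mem
  refine hfQ ?_
  rw [← hp]
  refine δ.mem_homogeneousCore.mpr fun n => ?_
  by_cases hn : n = F.natDegree
  · exact hn ▸ hmem
  · exact hQp (hzero n hn)

/-- Division with remainder, the width playing the part of the degree: up to factors that are
homogeneous modulo `Q` and outside `Q`, an element `f` of minimal width generates `p` modulo `Q`.
Each step cancels top components, which lowers the width of `g`. -/
theorem exists_component_mul_mem [Q.IsPrime] (hp : δ.homogeneousCore p = Q) {f : R}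
    (hf : f ∈ p) (hmin : ∀ g ∈ p, g ∉ Q → δ.width Q f ≤ δ.width Q g) (hfQ : f ∉ Q)
    (g : R) (hg : g ∈ p) :
    ∃ s n, δ.coactionMod Q s = C (Ideal.Quotient.mk Q s) * X ^ n ∧ s ∉ Q ∧
      s * g ∈ Ideal.span {f} ⊔ Q := by
  induction hw : δ.width Q g using Nat.strong_induction_on generalizing g with
  | _ w ih =>
  subst hw
  by_cases hgQ : g ∈ Q
  · exact ⟨1, 0, by simp, fun h => (inferInstance : Q.IsPrime).ne_top
      (Ideal.eq_top_of_isUnit_mem _ h isUnit_one), by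
      rw [one_mul]; exact Ideal.mem_sup_right hgQ⟩
  have hle := hmin g hg hgQ
  set F := δ.coactionMod Q f with hF
  set G := δ.coactionMod Q g with hG
  set s₁ := δ.component F.natDegree f with hs₁
  set s₂ := δ.component G.natDegree g with hs₂
  have hc₁ : δ.coactionMod Q s₁ = C F.leadingCoeff * X ^ F.natDegree := δ.coactionMod_component _ _ _
  have hc₂ : δ.coactionMod Q s₂ = C G.leadingCoeff * X ^ G.natDegree := δ.coactionMod_component _ _ _
  have hs₁m : F.leadingCoeff = Ideal.Quotient.mk Q s₁ := δ.coeff_coactionMod _ _ _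
  have hs₁Q : s₁ ∉ Q := by
    rw [← Ideal.Quotient.eq_zero_iff_mem, ← hs₁m, leadingCoeff_eq_zero]
    exact fun h => hfQ ((δ.coactionMod_eq_zero hp).mp h)
  have hH : δ.coactionMod Q (s₁ * g - s₂ * f) = C F.leadingCoeff * (X ^ F.natDegree * G) -
      C G.leadingCoeff * (X ^ G.natDegree * F) := by
    rw [map_sub, map_mul, map_mul, hc₁, hc₂, mul_assoc, mul_assoc]
  have hmem : s₁ * g - s₂ * f ∈ p := Ideal.sub_mem _ (p.mul_mem_left _ hg) (p.mul_mem_left _ hf)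
  have key : ∃ s n, δ.coactionMod Q s = C (Ideal.Quotient.mk Q s) * X ^ n ∧ s ∉ Q ∧
      s * (s₁ * g - s₂ * f) ∈ Ideal.span {f} ⊔ Q := by
    by_cases h0 : s₁ * g - s₂ * f ∈ Q
    · exact ⟨1, 0, by simp, fun h => (inferInstance : Q.IsPrime).ne_top
        (Ideal.eq_top_of_isUnit_mem _ h isUnit_one), by
        rw [one_mul]; exact Ideal.mem_sup_right h0⟩
    · exact ih _ (natDegree_sub_natTrailingDegree_lt hle hH
        (fun h => h0 ((δ.coactionMod_eq_zero hp).mp h))) _ hmem rfl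
  obtain ⟨s, n, hs, hsQ, hsm⟩ := key
  refine ⟨s * s₁, n + F.natDegree, ?_, ?_, ?_⟩
  · rw [map_mul, hs, hc₁, hs₁m, map_mul, C_mul, pow_add]
    ring
  · exact fun h => ((inferInstance : Q.IsPrime).mem_or_mem h).elim hsQ hs₁Q
  · have : s * s₁ * g = s * (s₁ * g - s₂ * f) + (s * s₂) * f := by ring
    rw [this]
    exact Ideal.add_mem _ hsm (Ideal.mem_sup_left
      (Ideal.mul_mem_left _ _ (Ideal.mem_span_singleton_self f)))

theorem exists_width_minimal (hlt : Q < p) :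
    ∃ f ∈ p, f ∉ Q ∧ ∀ g ∈ p, g ∉ Q → δ.width Q f ≤ δ.width Q g := by
  obtain ⟨-, f₀, hf₀p, hf₀Q⟩ := SetLike.lt_iff_le_and_exists.mp hlt
  obtain ⟨f, ⟨hfp, hfQ⟩, hmin⟩ := (measure (δ.width Q)).wf.has_min
    {f | f ∈ p ∧ f ∉ Q} ⟨f₀, hf₀p, hf₀Q⟩
  exact ⟨f, hfp, hfQ, fun g hg hgQ => not_lt.mp (hmin g ⟨hg, hgQ⟩)⟩

theorem width_mul [Q.IsPrime] {f g : R} (hf : δ.coactionMod Q f ≠ 0)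
    (hg : δ.coactionMod Q g ≠ 0) : δ.width Q (f * g) = δ.width Q f + δ.width Q g := by
  have h1 := natTrailingDegree_le_natDegree (δ.coactionMod Q f)
  have h2 := natTrailingDegree_le_natDegree (δ.coactionMod Q g)
  simp only [width, map_mul, natDegree_mul hf hg, natTrailingDegree_mul hf hg]
  omega

/-- There are no two different nonhomogeneous primes, one contained in the other, with the same
homogeneous core. -/
theorem le_of_homogeneousCore_eq [q.IsPrime] [p.IsPrime] (hq : δ.homogeneousCore q = Q)
    (hp : δ.homogeneousCore p = Q) (hQq : Q < q) (hqp : q ≤ p) : p ≤ q := by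
  have hQ : Q.IsPrime := hp ▸ δ.isPrime_homogeneousCore p
  obtain ⟨f, hfp, hfQ, hfmin⟩ := δ.exists_width_minimal (hQq.trans_le hqp)
  have hdiv := δ.exists_component_mul_mem hp hfp hfmin hfQ
  have hhom : ∀ s n, δ.coactionMod Q s = C (Ideal.Quotient.mk Q s) * X ^ n → s ∉ Q →
      δ.width Q s = 0 := by
    intro s n hs hsQ
    have h0 : Ideal.Quotient.mk Q s ≠ 0 := fun h => hsQ (Ideal.Quotient.eq_zero_iff_mem.mp h)
    rw [width, hs, natDegree_C_mul_X_pow _ _ h0, C_mul_X_pow_eq_monomial,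
      natTrailingDegree_monomial h0, Nat.sub_self]
  have hsq : ∀ s n, δ.coactionMod Q s = C (Ideal.Quotient.mk Q s) * X ^ n → s ∉ Q → s ∉ q := by
    intro s n hs hsQ h
    exact (δ.width_pos hq h hsQ).ne' (hhom s n hs hsQ)
  by_cases hfq : f ∈ q
  · intro g hg
    obtain ⟨s, n, hs, hsQ, hsg⟩ := hdiv g hg
    have : Ideal.span {f} ⊔ Q ≤ q := sup_le ((Ideal.span_singleton_le_iff_mem _).mpr hfq) hQq.le
    exact ((inferInstance : q.IsPrime).mem_or_mem (this hsg)).resolve_left (hsq s n hs hsQ)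
  -- If `f ∉ q`, take `h` of minimal width in `q`. Division gives `s h ≡ r f` modulo `Q` with `r ∈
  -- q`. Widths add and `s` has width zero, so `r` is strictly narrower than `h`.
  · exfalso
    obtain ⟨h, hhq, hhQ, hhmin⟩ := δ.exists_width_minimal hQq
    obtain ⟨s, n, hs, hsQ, hsh⟩ := hdiv h (hqp hhq)
    obtain ⟨x, hx, z, hz, hxz⟩ := Submodule.mem_sup.mp hsh
    obtain ⟨r, rfl⟩ := Ideal.mem_span_singleton'.mp hx
    have hrf : r * f ∈ q := by
      have : r * f = s * h - z := by rw [← hxz]; ring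
      rw [this]
      exact Ideal.sub_mem _ (q.mul_mem_left _ hhq) (hQq.le hz)
    have hrq : r ∈ q := ((inferInstance : q.IsPrime).mem_or_mem hrf).resolve_right hfq
    have hshQ : s * h ∉ Q := fun hm => (hQ.mem_or_mem hm).elim hsQ hhQ
    have hrQ : r ∉ Q := by
      intro hr
      refine hshQ ?_
      rw [← hxz]
      exact Ideal.add_mem _ (Q.mul_mem_right _ hr) hz
    have hne : ∀ y, y ∉ Q → δ.coactionMod Q y ≠ 0 := fun y hy h0 => hy ((δ.coactionMod_eq_zero hp).mp h0)
    have hw : δ.width Q (s * h) = δ.width Q (r * f) := by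
      simp only [width]
      rw [← hxz, map_add, (δ.coactionMod_eq_zero hp).mpr hz, add_zero]
    rw [δ.width_mul (hne s hsQ) (hne h hhQ), δ.width_mul (hne r hrQ) (hne f hfQ), hhom s n hs hsQ] at hw
    have := hhmin r hrq hrQ
    have := δ.width_pos hp hfp hfQ
    omega

end

/-- Passing from a prime to its homogeneous core lowers its height by at most one. -/
theorem _root_.HasPrimeChain.homogeneousCore {Q : Ideal R}
    (hQ : δ.IsHomogeneousIdeal Q) {n : ℕ} {p : PrimeSpectrum R}
    (h : HasPrimeChain Q (n + 1) p) :
    HasPrimeChain Q n ⟨δ.homogeneousCore p.asIdeal, inferInstance⟩ := by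
  induction n generalizing p with
  | zero =>
    obtain ⟨q, hq, h⟩ := HasPrimeChain.succ_iff.mp h
    exact HasPrimeChain.zero_iff.mpr (hQ.le_homogeneousCore (h.le.trans hq.le))
  | succ n ih =>
    obtain ⟨q, hq, h⟩ := HasPrimeChain.succ_iff.mp h
    have hqh := ih h
    have hle : δ.homogeneousCore q.asIdeal ≤ δ.homogeneousCore p.asIdeal :=
      Ideal.comap_mono (Ideal.map_mono hq.le)
    -- If `q` is homogeneous, the chain ending at `q` already lies below the core of `p`. Otherwise
    -- the two cores differ, since `q` and `p` would be two comparable nonhomogeneous primes over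
    -- one core.
    by_cases heq : δ.homogeneousCore q.asIdeal = q.asIdeal
    · exact h.mono le_rfl (show q.asIdeal ≤ _ from heq ▸ hle)
    · refine HasPrimeChain.succ_iff.mpr ⟨_, lt_of_le_of_ne hle fun hc => ?_, hqh⟩
      have hc' : δ.homogeneousCore q.asIdeal =
          δ.homogeneousCore p.asIdeal := congrArg PrimeSpectrum.asIdeal hc
      exact hq.not_ge (δ.le_of_homogeneousCore_eq hc' rfl
        (lt_of_le_of_ne (hc' ▸ δ.homogeneousCore_le _) (hc' ▸ heq)) hq.le)

end GradingCoaction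

/-! ### The grading of the Rees algebra -/

namespace reesAlgebra

open Polynomial

variable {A : Type u} [CommRing A] {I : Ideal A}

/-- The homogeneous component of degree `n` of an element of the Rees algebra. -/
def component (n : ℕ) (f : reesAlgebra I) : reesAlgebra I :=
  ⟨monomial n (f.1.coeff n), reesAlgebra.monomial_mem.mpr (f.2 n)⟩

theorem coe_component (n : ℕ) (f : reesAlgebra I) :
    (component n f : A[X]) = monomial n (f.1.coeff n) := rfl

theorem component_zero (n : ℕ) : component n (0 : reesAlgebra I) = 0 := by
  ext; simp [coe_component]

theorem component_add (n : ℕ) (f g : reesAlgebra I) :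
    component n (f + g) = component n f + component n g := by
  apply Subtype.ext
  simp [coe_component]

theorem component_component (m n : ℕ) (f : reesAlgebra I) :
    component m (component n f) = if m = n then component n f else 0 := by
  apply Subtype.ext
  split_ifs with h
  · subst h
    simp [coe_component]
  · simp [coe_component, coeff_monomial, Ne.symm h]

theorem component_mul (n : ℕ) (f g : reesAlgebra I) : component n (f * g) =
    ∑ x ∈ Finset.HasAntidiagonal.antidiagonal n, component x.1 f * component x.2 g := by
  apply Subtype.ext
  rw [AddSubmonoidClass.coe_finsetSum]
  simp only [coe_component, MulMemClass.coe_mul, coeff_mul, map_sum, monomial_mul_monomial]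
  refine Finset.sum_congr rfl fun x hx => ?_
  rw [Finset.HasAntidiagonal.mem_antidiagonal.mp hx]

theorem component_one (n : ℕ) : component n (1 : reesAlgebra I) = if n = 0 then 1 else 0 := by
  apply Subtype.ext
  rw [coe_component]
  split_ifs with h
  · subst h; simp
  · simp [coeff_one, h]

theorem sum_component (f : reesAlgebra I) : ∑ n ∈ f.1.support, component n f = f := by
  apply Subtype.ext
  rw [AddSubmonoidClass.coe_finsetSum]
  exact f.1.sum_monomial_eq

variable (I) in
/-- The coaction `f ↦ ∑ fₙ Yⁿ` which describes the grading of the Rees algebra. -/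
def coaction : reesAlgebra I →+* (reesAlgebra I)[X] :=
  have coeff_aux : ∀ (f : reesAlgebra I) (n : ℕ),
      (∑ i ∈ f.1.support, monomial i (component i f)).coeff n = component n f := by
    intro f n
    simp only [finsetSum_coeff, coeff_monomial, Finset.sum_ite_eq', mem_support_iff]
    split_ifs with h
    · rfl
    · apply Subtype.ext
      simp [coe_component, notMem_support_iff.mp h]
  { toFun := fun f => ∑ n ∈ f.1.support, monomial n (component n f)
    map_one' := by
      ext1 n
      rw [coeff_aux, component_one, coeff_one]
    map_zero' := by
      ext1 n
      rw [coeff_aux, component_zero, coeff_zero]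
    map_add' := fun f g => by
      ext1 n
      rw [coeff_add, coeff_aux, coeff_aux, coeff_aux, component_add]
    map_mul' := fun f g => by
      ext1 n
      rw [coeff_mul, coeff_aux, component_mul]
      exact Finset.sum_congr rfl fun x _ => by rw [coeff_aux, coeff_aux] }

theorem coeff_coaction (f : reesAlgebra I) (n : ℕ) : (coaction I f).coeff n = component n f := by
  change (∑ i ∈ f.1.support, monomial i (component i f)).coeff n = component n f
  simp only [finsetSum_coeff, coeff_monomial, Finset.sum_ite_eq', mem_support_iff]
  split_ifs with h
  · rfl
  · apply Subtype.ext
    simp [coe_component, notMem_support_iff.mp h]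

variable (I) in
/-- The grading of the Rees algebra. -/
def gradingCoaction : GradingCoaction (reesAlgebra I) where
  toHom := coaction I
  eval_one f := by
    have hs : (coaction I f).support ⊆ f.1.support := by
      intro n hn
      rw [mem_support_iff, coeff_coaction] at hn
      rw [mem_support_iff]
      intro h
      exact hn (Subtype.ext (by simp [coe_component, h]))
    rw [eval_eq_sum, sum_def,
      Finset.sum_subset hs (fun n _ hn => by rw [notMem_support_iff.mp hn, zero_mul])]
    simp only [coeff_coaction, one_pow, mul_one]
    exact sum_component f
  coeff_coeff f m n := by
    rw [coeff_coaction, coeff_coaction, component_component]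

theorem gradingCoaction_component (n : ℕ) (f : reesAlgebra I) :
    (gradingCoaction I).component n f = component n f := coeff_coaction f n

end reesAlgebra

/-! ### Dimension of Rees algebras: upper bound -/

section UpperBound

open Polynomial

/-- Adjoining an algebraic element to a Noetherian subalgebra of a domain does not raise
the dimension. -/
theorem ringKrullDim_adjoin_insert_le {D E : Type*} [CommRing D] [CommRing E] [IsDomain E]
    [Algebra D E] (s : Set E) (x : E) [IsNoetherianRing (Algebra.adjoin D s)]
    (hx : ∃ f : (Algebra.adjoin D s)[X], f ≠ 0 ∧ aeval x f = 0) :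
    ringKrullDim (Algebra.adjoin D (insert x s)) ≤ ringKrullDim (Algebra.adjoin D s) := by
  obtain ⟨f, hf0, hf⟩ := hx
  have e1 : Algebra.adjoin D (insert x s) =
      ((aeval x : (Algebra.adjoin D s)[X] →ₐ[Algebra.adjoin D s] E).range).restrictScalars D := by
    rw [← Set.union_singleton, Algebra.adjoin_union_eq_adjoin_adjoin,
      Algebra.adjoin_singleton_eq_range_aeval]
  have e2 : ringKrullDim (Algebra.adjoin D (insert x s)) =
      ringKrullDim (aeval x : (Algebra.adjoin D s)[X] →ₐ[Algebra.adjoin D s] E).range := by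
    rw [e1]; rfl
  -- Adjoining a variable raises the dimension by one, and the nonzero relation `f`, a
  -- nonzerodivisor in the kernel, lowers it again by at least one.
  have h := ringKrullDim_succ_le_of_surjective
    (aeval x : (Algebra.adjoin D s)[X] →ₐ[Algebra.adjoin D s] E).rangeRestrict.toRingHom
    (AlgHom.rangeRestrict_surjective _) (r := f) (mem_nonZeroDivisors_of_ne_zero hf0)
    (Subtype.ext hf)
  rw [e2]
  rw [Polynomial.ringKrullDim_of_isNoetherianRing] at h
  exact ENat.WithBot.add_le_add_one_right_iff.mp h

/-- A domain generated over `D` by elements `b X`, for finitely many `b ∈ D`, has dimension at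
most `dim D + 1`. -/
theorem ringKrullDim_adjoin_monomial_le {D : Type*} [CommRing D] [IsDomain D] [IsNoetherianRing D]
    (s : Finset D) :
    ringKrullDim (Algebra.adjoin D ((fun b => monomial 1 b : D → D[X]) '' s)) ≤
      ringKrullDim D + 1 := by
  classical
  by_cases hs : ∃ b ∈ s, b ≠ 0
  · obtain ⟨b, hbs, hb0⟩ := hs
    have key : ∀ t : Finset D, ringKrullDim (Algebra.adjoin D
        ((fun b => monomial 1 b : D → D[X]) '' (insert b t : Finset D))) ≤ ringKrullDim D + 1 := by
      intro t
      induction t using Finset.induction_on with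
      | empty =>
        rw [insert_empty_eq, Finset.coe_singleton, Set.image_singleton,
          Algebra.adjoin_singleton_eq_range_aeval, ← Polynomial.ringKrullDim_of_isNoetherianRing]
        exact ringKrullDim_le_of_surjective
          (aeval (monomial 1 b : D[X]) : D[X] →ₐ[D] D[X]).rangeRestrict.toRingHom
          (AlgHom.rangeRestrict_surjective _)
      | insert c t _ ih =>
        rw [Finset.insert_comm, Finset.coe_insert, Set.image_insert_eq]
        refine le_trans ?_ ih
        set S := (fun b => monomial 1 b : D → D[X]) '' (insert b t : Finset D) with hS
        have : IsNoetherianRing (Algebra.adjoin D S) :=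
          isNoetherianRing_of_fg (Subalgebra.fg_def.mpr ⟨S, (Finset.finite_toSet _).image _, rfl⟩)
        have hbS : (monomial 1 b : D[X]) ∈ Algebra.adjoin D S :=
          Algebra.subset_adjoin ⟨b, by simp, rfl⟩
        -- The relation is `b · (cX) = c · (bX)`. A fixed nonzero `b` is kept among the generators
        -- so that it is nontrivial.
        refine ringKrullDim_adjoin_insert_le S _ ⟨C (algebraMap D (Algebra.adjoin D S) b) * X -
          C (algebraMap D (Algebra.adjoin D S) c * ⟨_, hbS⟩), ?_, ?_⟩
        · intro h
          have := congrArg (fun f => f.coeff 1) h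
          simp only [coeff_sub, coeff_C_mul, coeff_X_one, mul_one, coeff_C_succ, sub_zero,
            coeff_zero] at this
          have h2 := congrArg (fun z : Algebra.adjoin D S => (z : D[X])) this
          simp only [Subalgebra.coe_algebraMap, ZeroMemClass.coe_zero] at h2
          exact hb0 (C_injective (h2.trans C_0.symm))
        · rw [aeval_def, eval₂_sub, eval₂_mul, eval₂_C, eval₂_X, eval₂_C]
          change C b * monomial 1 c - C c * monomial 1 b = 0
          rw [C_mul_monomial, C_mul_monomial, mul_comm, sub_self]
    have := key s
    rwa [Finset.insert_eq_of_mem hbs] at this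
  · push Not at hs
    have : Algebra.adjoin D ((fun b => monomial 1 b : D → D[X]) '' s) = ⊥ := by
      rw [eq_bot_iff, Algebra.adjoin_le_iff]
      rintro _ ⟨b, hb, rfl⟩
      simp [hs b hb]
    rw [this]
    refine le_trans (ringKrullDim_le_of_surjective
      (algebraMap D (⊥ : Subalgebra D D[X])) ?_) ?_
    · rintro ⟨x, hx⟩
      obtain ⟨y, rfl⟩ := Algebra.mem_bot.mp hx
      exact ⟨y, rfl⟩
    · rw [← Polynomial.ringKrullDim_of_isNoetherianRing]
      exact ringKrullDim_le_of_surjective (Polynomial.evalRingHom (0 : D))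
        (fun d => ⟨C d, by simp⟩)

theorem ringKrullDim_reesAlgebra_le {D : Type*} [CommRing D] [IsDomain D] [IsNoetherianRing D]
    (I : Ideal D) : ringKrullDim (reesAlgebra I) ≤ ringKrullDim D + 1 := by
  obtain ⟨s, rfl⟩ := (isNoetherianRing_iff_ideal_fg D).mp ‹_› I
  have : reesAlgebra (Ideal.span (s : Set D)) =
      Algebra.adjoin D ((fun b => monomial 1 b : D → D[X]) '' s) := by
    rw [← adjoin_monomial_eq_reesAlgebra, Ideal.span, Submodule.map_span, Algebra.adjoin_span]
  rw [this]
  exact ringKrullDim_adjoin_monomial_le s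

end UpperBound

/-! ### Quotients of the Rees algebra by ideals of coefficients -/

namespace reesAlgebra

open Polynomial

variable {A : Type u} [CommRing A] (I : Ideal A)

/-- The ideal of the elements of the Rees algebra all of whose coefficients lie in `q`. -/
def coeffIdeal (q : Ideal A) : Ideal (reesAlgebra I) :=
  (q.map C).comap (reesAlgebra I).val.toRingHom

variable {I}

theorem mem_coeffIdeal {q : Ideal A} {f : reesAlgebra I} :
    f ∈ coeffIdeal I q ↔ ∀ n, f.1.coeff n ∈ q := by
  rw [coeffIdeal, Ideal.mem_comap, Ideal.mem_map_C_iff]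
  rfl

instance isPrime_coeffIdeal (q : Ideal A) [q.IsPrime] : (coeffIdeal I q).IsPrime :=
  have := Ideal.isPrime_map_C_of_isPrime (P := q)
  Ideal.comap_isPrime _ _

variable (I) in
/-- The map of Rees algebras induced by a quotient map of rings. -/
def mapQuotient (q : Ideal A) : reesAlgebra I →+* reesAlgebra (I.map (Ideal.Quotient.mk q)) :=
  ((mapRingHom (Ideal.Quotient.mk q)).comp (reesAlgebra I).val.toRingHom).codRestrict
    (reesAlgebra (I.map (Ideal.Quotient.mk q))).toSubring (fun f i => by
      change (Polynomial.map (Ideal.Quotient.mk q) f.1).coeff i ∈ _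
      rw [coeff_map, ← Ideal.map_pow]
      exact Ideal.mem_map_of_mem _ (f.2 i))

theorem coe_mapQuotient (q : Ideal A) (f : reesAlgebra I) :
    (mapQuotient I q f : (A ⧸ q)[X]) = Polynomial.map (Ideal.Quotient.mk q) f.1 := rfl

theorem ker_mapQuotient (q : Ideal A) : RingHom.ker (mapQuotient I q) = coeffIdeal I q := by
  ext f
  rw [RingHom.mem_ker, mem_coeffIdeal, ← Subtype.coe_inj, coe_mapQuotient, Polynomial.ext_iff]
  simp [Ideal.Quotient.eq_zero_iff_mem]

theorem mapQuotient_surjective (q : Ideal A) : Function.Surjective (mapQuotient I q) := by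
  intro g
  have hlift : ∀ n, ∃ c ∈ I ^ n, Ideal.Quotient.mk q c = g.1.coeff n := by
    intro n
    have := g.2 n
    rw [← Ideal.map_pow] at this
    exact (Ideal.mem_map_iff_of_surjective _ Ideal.Quotient.mk_surjective).mp this
  choose c hc hcg using hlift
  refine ⟨∑ n ∈ g.1.support, ⟨monomial n (c n), monomial_mem.mpr (hc n)⟩, ?_⟩
  apply Subtype.ext
  rw [coe_mapQuotient, AddSubmonoidClass.coe_finsetSum, Polynomial.map_sum]
  simp only [map_monomial, hcg]
  exact g.1.sum_monomial_eq

/-- The quotient is the Rees algebra of the image of `I` in the domain `A / q`. -/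
theorem ringKrullDim_quotient_coeffIdeal_le [IsNoetherianRing A] (q : Ideal A) [q.IsPrime] :
    ringKrullDim (reesAlgebra I ⧸ coeffIdeal I q) ≤ ringKrullDim (A ⧸ q) + 1 := by
  rw [ringKrullDim_eq_of_ringEquiv ((Ideal.quotEquivOfEq (ker_mapQuotient q).symm).trans
    (RingHom.quotientKerEquivOfSurjective (mapQuotient_surjective (I := I) q)))]
  exact ringKrullDim_reesAlgebra_le _

/-- Chains of primes over an ideal containing all elements of positive degree contract to chains
of primes of `A`. -/
theorem hasPrimeChain_comap_of_irrelevant_le {Q : Ideal (reesAlgebra I)}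
    (hQ : ∀ n, 1 ≤ n → ∀ f : reesAlgebra I, component n f ∈ Q) {n : ℕ}
    {p : PrimeSpectrum (reesAlgebra I)} (h : HasPrimeChain Q n p) :
    HasPrimeChain (Q.comap (algebraMap A (reesAlgebra I))) n
      (PrimeSpectrum.comap (algebraMap A (reesAlgebra I)) p) := by
  have hcomp : ∀ f : reesAlgebra I, component 0 f = algebraMap A _ (f.1.coeff 0) := fun f => rfl
  have hsub : ∀ f : reesAlgebra I, f - algebraMap A _ (f.1.coeff 0) ∈ Q := by
    intro f
    by_cases h0 : 0 ∈ f.1.support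
    · have := sum_component f
      rw [← Finset.add_sum_erase _ _ h0, hcomp] at this
      rw [sub_eq_iff_eq_add'.mpr this.symm]
      exact Ideal.sum_mem _ fun n hn => hQ n (Nat.pos_of_ne_zero (Finset.ne_of_mem_erase hn)) f
    · rw [notMem_support_iff.mp h0, map_zero, sub_zero, ← sum_component f]
      refine Ideal.sum_mem _ fun n hn => hQ n (Nat.pos_of_ne_zero ?_) f
      rintro rfl
      exact h0 hn
  refine h.comap _ fun q q' hq hqq' => lt_of_le_not_ge (Ideal.comap_mono hqq'.le) fun hle => ?_
  refine hqq'.not_ge fun f hf => ?_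
  have h1 : algebraMap A _ (f.1.coeff 0) ∈ q'.asIdeal := by
    have := q'.asIdeal.sub_mem hf (hqq'.le (hq (hsub f)))
    rwa [sub_sub_cancel] at this
  have h2 : algebraMap A _ (f.1.coeff 0) ∈ q.asIdeal := hle h1
  have := q.asIdeal.add_mem (hq (hsub f)) h2
  rwa [sub_add_cancel] at this

theorem component_mem_of_map_le {Q : Ideal (reesAlgebra I)} {q : Ideal A} (hI : I ≤ q)
    (hq : coeffIdeal I q ≤ Q) (n : ℕ) (hn : 1 ≤ n) (f : reesAlgebra I) : component n f ∈ Q := by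
  refine hq (mem_coeffIdeal.mpr fun m => ?_)
  rw [coe_component, coeff_monomial]
  split_ifs with h
  · exact hI (Ideal.pow_le_self (by omega) (f.2 n))
  · exact q.zero_mem

/-- The quotient of the Rees algebra by `I` and all polynomials with coefficients in `𝔞` has
dimension at most `dim A/𝔞`. -/
theorem ringKrullDim_quotient_sup_le [IsNoetherianRing A] (𝔞 : Ideal A) {d : ℕ}
    (hd : ringKrullDim (A ⧸ 𝔞) ≤ d) :
    ringKrullDim (reesAlgebra I ⧸ (I.map (algebraMap A (reesAlgebra I)) ⊔ coeffIdeal I 𝔞)) ≤ d := by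
  rw [ringKrullDim_quotient_le_iff]
  intro n p h
  obtain ⟨P, hP, h⟩ := h.exists_prime
  obtain ⟨P₁, hP₁, hle⟩ := Ideal.exists_minimalPrimes_le (le_sup_right.trans hP)
  -- A minimal prime over a contracted ideal is itself contracted, here from `A[X]`. Its trace `q`
  -- on `A` contains `𝔞`, and `P` contains `coeffIdeal I q`.
  obtain ⟨P', hP'prime, hP'le, hP'⟩ := Ideal.exists_comap_eq_of_mem_minimalPrimes _ P₁ hP₁
  have hq : (P'.comap C).IsPrime := Ideal.comap_isPrime _ _
  have h𝔞q : 𝔞 ≤ P'.comap C := Ideal.map_le_iff_le_comap.mp hP'le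
  have hqP : coeffIdeal I (P'.comap C) ≤ P.asIdeal := by
    refine le_trans ?_ hle
    rw [← hP']
    exact Ideal.comap_mono Ideal.map_comap_le
  have hdq : ringKrullDim (A ⧸ P'.comap C) ≤ d :=
    le_trans (ringKrullDim_le_of_surjective (Ideal.Quotient.factor h𝔞q)
      (Ideal.Quotient.factor_surjective h𝔞q)) hd
  by_cases hI : I ≤ P'.comap C
  · have h1 := hasPrimeChain_comap_of_irrelevant_le (component_mem_of_map_le hI hqP) h
    refine (h1.mono (Q' := P'.comap C) (fun a ha => hqP ?_) le_rfl).le_of_ringKrullDim_le hdq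
    rw [mem_coeffIdeal]
    intro n
    change (C a).coeff n ∈ _
    rw [coeff_C]
    split_ifs
    · exact ha
    · exact Ideal.zero_mem _
  -- When `I ⊄ q`, the prime `P` contains `I` but `coeffIdeal I q` does not. The strict inclusion
  -- absorbs the extra one in the bound `dim A/q + 1`.
  · have hlt : coeffIdeal I (P'.comap C) < P.asIdeal := by
      refine lt_of_le_of_ne hqP fun heq => hI fun b hb => ?_
      have hb' : algebraMap A (reesAlgebra I) b ∈ P.asIdeal :=
        hP (Ideal.mem_sup_left (Ideal.mem_map_of_mem _ hb))
      rw [← heq, mem_coeffIdeal] at hb'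
      have := hb' 0
      change (C b).coeff 0 ∈ _ at this
      rwa [coeff_C_zero] at this
    have h1 := (h.cons (P := ⟨coeffIdeal I (P'.comap C), inferInstance⟩) hlt).le_ringKrullDim
    have h2 := h1.trans ((ringKrullDim_quotient_coeffIdeal_le _).trans (add_le_add_left hdq 1))
    have h3 : n + 1 ≤ d + 1 := by exact_mod_cast h2
    omega

end reesAlgebra

/-! ### Dimension of Rees algebras: lower bound -/

namespace reesAlgebra

open Polynomial LaurentPolynomial

theorem _root_.LaurentPolynomial.coeff_C_mul_T {A : Type*} [CommRing A] (a : A) (n m : ℤ) :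
    (LaurentPolynomial.C a * T n).coeff m = if n = m then a else 0 := by
  rw [← single_eq_C_mul_T, AddMonoidAlgebra.coeff_single, Finsupp.single_apply]

theorem _root_.LaurentPolynomial.coeff_toLaurent_mul_T {A : Type*} [CommRing A] (p : A[X])
    (j : ℕ) : (toLaurent p * T (-(j : ℤ))).coeff 0 = p.coeff j := by
  induction p using Polynomial.induction_on' with
  | add p q hp hq => rw [map_add, add_mul, AddMonoidAlgebra.coeff_add, Finsupp.add_apply, hp, hq,
      Polynomial.coeff_add]
  | monomial n a =>
    rw [toLaurent_C_mul_T, mul_assoc, ← T_add, LaurentPolynomial.coeff_C_mul_T, coeff_monomial]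
    congr 1
    rw [eq_iff_iff]
    omega

theorem _root_.RingHom.mem_ker_sup_of_map_eq {S T : Type*} [CommRing S] [CommRing T] (φ : S →+* T)
    {K : Ideal S} {x y : S} (h : φ x = φ y) (hy : y ∈ K) : x ∈ RingHom.ker φ ⊔ K := by
  rw [← sub_add_cancel x y]
  exact Ideal.add_mem _ (Ideal.mem_sup_left (RingHom.sub_mem_ker_iff φ |>.mpr h))
    (Ideal.mem_sup_right hy)

variable {A : Type u} [CommRing A] (I : Ideal A)

/-- The homomorphism from polynomials over the Rees algebra onto the extended Rees algebra
`A[It, t⁻¹]`, which sends the variable to `t⁻¹`. -/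
def toExtended : (reesAlgebra I)[X] →+* A[T;T⁻¹] :=
  eval₂RingHom (toLaurent.comp (reesAlgebra I).val.toRingHom) (T (-1))

theorem toExtended_C (f : reesAlgebra I) : toExtended I (Polynomial.C f) = toLaurent f.1 :=
  eval₂_C _ _

theorem toExtended_X : toExtended I X = T (-1) := eval₂_X _ _

/-- The term `f.coeff n` is multiplied by `t⁻ⁿ`, so it contributes its coefficient in degree `n`.
This lies in `Iⁿ`, hence in `I` as soon as `n ≥ 1`. -/
theorem coeff_toExtended_sub_mem (f : (reesAlgebra I)[X]) :
    (toExtended I f).coeff 0 - (f.coeff 0).1.coeff 0 ∈ I := by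
  induction f using Polynomial.induction_on' with
  | add p q hp hq =>
    rw [map_add, AddMonoidAlgebra.coeff_add, Finsupp.add_apply, Polynomial.coeff_add]
    convert I.add_mem hp hq using 1
    rw [Subalgebra.coe_add, Polynomial.coeff_add]
    ring
  | monomial n a =>
    have h : (toExtended I (monomial n a)).coeff 0 = a.1.coeff n := by
      rw [← C_mul_X_pow_eq_monomial, map_mul, map_pow, toExtended_C, toExtended_X, T_pow,
        ← LaurentPolynomial.coeff_toLaurent_mul_T]
      simp
    rw [h, coeff_monomial]
    split_ifs with hn
    · subst hn
      simp
    · rw [ZeroMemClass.coe_zero, Polynomial.coeff_zero, sub_zero]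
      exact Ideal.pow_le_self hn (a.2 n)

/-- The contraction of `q A[t, t⁻¹]` along `reesAlgebra.toExtended`. -/
def extendedIdeal (q : Ideal A) : Ideal (reesAlgebra I)[X] :=
  RingHom.ker ((AddMonoidAlgebra.mapRingHom ℤ (Ideal.Quotient.mk q)).comp (toExtended I))

variable {I}

theorem mem_extendedIdeal {q : Ideal A} {f : (reesAlgebra I)[X]} :
    f ∈ extendedIdeal I q ↔ ∀ m, (toExtended I f).coeff m ∈ q := by
  rw [extendedIdeal, RingHom.mem_ker]
  simp only [← Ideal.Quotient.eq_zero_iff_mem]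
  constructor
  · intro h m
    rw [← AddMonoidAlgebra.coeff_mapRingHom]
    exact congrArg (fun x => AddMonoidAlgebra.coeff x m) h
  · intro h
    refine LaurentPolynomial.ext fun m => ?_
    rw [RingHom.comp_apply, AddMonoidAlgebra.coeff_mapRingHom]
    exact h m

instance isPrime_extendedIdeal (q : Ideal A) [q.IsPrime] : (extendedIdeal I q).IsPrime := by
  have : IsDomain (A ⧸ q)[T;T⁻¹] := inferInstance
  exact RingHom.ker_isPrime _

theorem extendedIdeal_mono {q q' : Ideal A} (h : q ≤ q') :
    extendedIdeal I q ≤ extendedIdeal I q' :=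
  fun _ hf => mem_extendedIdeal.mpr fun m => h (mem_extendedIdeal.mp hf m)

theorem le_of_extendedIdeal_le {q q' : Ideal A} (h : extendedIdeal I q ≤ extendedIdeal I q') :
    q ≤ q' := by
  intro a ha
  have hval : toExtended I (Polynomial.C (algebraMap A (reesAlgebra I) a)) =
      LaurentPolynomial.C a := by
    rw [toExtended_C]
    exact toLaurent_C a
  have h1 : Polynomial.C (algebraMap A (reesAlgebra I) a) ∈ extendedIdeal I q := by
    refine mem_extendedIdeal.mpr fun m => ?_
    rw [hval, ← mul_one (LaurentPolynomial.C a), ← T_zero, LaurentPolynomial.coeff_C_mul_T]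
    split_ifs
    · exact ha
    · exact q.zero_mem
  have h2 := mem_extendedIdeal.mp (h h1) 0
  rwa [hval, ← mul_one (LaurentPolynomial.C a), ← T_zero, LaurentPolynomial.coeff_C_mul_T,
    if_pos rfl] at h2

theorem hasPrimeChain_extendedIdeal {Q : Ideal A} {n : ℕ} {p : PrimeSpectrum A}
    (h : HasPrimeChain Q n p) :
    HasPrimeChain (R := (reesAlgebra I)[X]) (extendedIdeal I Q) n
      ⟨extendedIdeal I p.asIdeal, inferInstance⟩ := by
  induction n generalizing p with
  | zero => exact HasPrimeChain.zero_iff.mpr (extendedIdeal_mono h.le)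
  | succ n ih =>
    obtain ⟨q, hq, h⟩ := HasPrimeChain.succ_iff.mp h
    refine HasPrimeChain.succ_iff.mpr ⟨_, lt_of_le_not_ge ?_ fun hle => ?_, ih h⟩
    · exact extendedIdeal_mono hq.le
    · exact hq.not_ge (le_of_extendedIdeal_le (I := I) hle)

variable (I) in
/-- The homogeneous maximal ideal of the Rees algebra. -/
def maximalIdealHom [IsLocalRing A] : Ideal (reesAlgebra I) :=
  (maximalIdeal A).comap (constantCoeff.comp (reesAlgebra I).val.toRingHom)

theorem mem_maximalIdealHom [IsLocalRing A] {f : reesAlgebra I} :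
    f ∈ maximalIdealHom I ↔ f.1.coeff 0 ∈ maximalIdeal A := Iff.rfl

instance isPrime_maximalIdealHom [IsLocalRing A] : (maximalIdealHom I).IsPrime :=
  Ideal.comap_isPrime _ _

instance isMaximal_maximalIdealHom [IsLocalRing A] : (maximalIdealHom I).IsMaximal := by
  refine Ideal.comap_isMaximal_of_surjective _ fun a => ⟨algebraMap A _ a, ?_⟩
  exact coeff_C_zero

/-- The variable goes to the unit `t⁻¹` of the Laurent polynomials, so it is outside the left side.
This strict step supplies the extra prime that is lost later on cutting by `t⁻¹`. -/
theorem extendedIdeal_lt [IsLocalRing A] (hI : I ≤ maximalIdeal A) :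
    extendedIdeal I (maximalIdeal A) < (maximalIdealHom I).comap (evalRingHom 0) := by
  refine lt_of_le_not_ge (fun f hf => ?_) fun hle => ?_
  · rw [Ideal.mem_comap, coe_evalRingHom, ← coeff_zero_eq_eval_zero, mem_maximalIdealHom]
    have := (maximalIdeal A).sub_mem (mem_extendedIdeal.mp hf 0) (hI (coeff_toExtended_sub_mem I f))
    rwa [sub_sub_cancel] at this
  · have h1 : (X : (reesAlgebra I)[X]) ∈ (maximalIdealHom I).comap (evalRingHom 0) := by
      rw [Ideal.mem_comap, coe_evalRingHom, eval_X]
      exact Ideal.zero_mem _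
    have h2 := mem_extendedIdeal.mp (hle h1) (-1)
    rw [toExtended_X, T_apply, if_pos rfl] at h2
    exact (inferInstance : (maximalIdeal A).IsPrime).ne_top (Ideal.eq_top_of_isUnit_mem _ h2 isUnit_one)

/-- In the extended Rees algebra `b = (bt) · t⁻¹`, so killing `t⁻¹` kills `I`. -/
theorem C_algebraMap_mem (q : Ideal A) {b : A} (hb : b ∈ I) :
    (Polynomial.C (algebraMap A (reesAlgebra I) b) : (reesAlgebra I)[X]) ∈
      extendedIdeal I q ⊔ Ideal.span {X} := by
  have hbI : monomial 1 b ∈ reesAlgebra I := monomial_mem.mpr (by simpa using hb)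
  have e1 : toLaurent (monomial 1 b) = LaurentPolynomial.C b * T 1 := toLaurent_C_mul_T 1 b
  have e2 : toLaurent (algebraMap A (reesAlgebra I) b).1 = LaurentPolynomial.C b := toLaurent_C b
  have hmap : toExtended I (Polynomial.C (algebraMap A (reesAlgebra I) b)) =
      toExtended I (Polynomial.C ⟨_, hbI⟩ * X) := by
    rw [map_mul, toExtended_C, toExtended_C, toExtended_X, e1, e2, mul_assoc, ← T_add]
    simp
  have := RingHom.mem_ker_sup_of_map_eq (S := (reesAlgebra I)[X])
    ((AddMonoidAlgebra.mapRingHom ℤ (Ideal.Quotient.mk q)).comp (toExtended I))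
    (K := Ideal.span {X})
    (congrArg (AddMonoidAlgebra.mapRingHom ℤ (Ideal.Quotient.mk q)) hmap)
    (Ideal.mul_mem_left _ _ (Ideal.mem_span_singleton_self _))
  exact this

/-- The lower bound for `dim G_I(M)`: a chain of length `d` in `A` gives one of length `d + 1` over
the extended Rees algebra, and cutting by `t⁻¹` leaves length `d`. -/
theorem hasPrimeChain_maximalIdealHom [IsLocalRing A] [IsNoetherianRing A]
    (hI : I ≤ maximalIdeal A) {q : Ideal A} {d : ℕ} (h : HasPrimeChain q d (closedPoint A)) :
    HasPrimeChain (I.map (algebraMap A (reesAlgebra I)) ⊔ coeffIdeal I q) d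
      ⟨maximalIdealHom I, inferInstance⟩ := by
  let N : PrimeSpectrum (reesAlgebra I)[X] :=
    ⟨(maximalIdealHom I).comap (evalRingHom 0), Ideal.comap_isPrime _ _⟩
  have h1 : HasPrimeChain (R := (reesAlgebra I)[X]) (extendedIdeal I q) (d + 1) N :=
    HasPrimeChain.succ_iff.mpr ⟨_, extendedIdeal_lt hI, hasPrimeChain_extendedIdeal h⟩
  have hXN : (X : (reesAlgebra I)[X]) ∈ N.asIdeal := by
    change (evalRingHom 0) X ∈ maximalIdealHom I
    rw [coe_evalRingHom, eval_X]
    exact Ideal.zero_mem _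
  have h2 := h1.cut hXN
  -- Primes containing the variable are determined by their constants, so the chain stays strict
  -- after contraction to the Rees algebra.
  have h3 := h2.comap (Polynomial.C : reesAlgebra I →+* (reesAlgebra I)[X]) (by
    intro q q' hq hqq'
    refine lt_of_le_not_ge (Ideal.comap_mono hqq'.le) fun hle => hqq'.not_ge fun f hf => ?_
    have hX : (X : (reesAlgebra I)[X]) ∈ q.asIdeal :=
      hq (Ideal.mem_sup_right (Ideal.mem_span_singleton_self _))
    rw [← f.divX_mul_X_add] at hf ⊢
    have hC : Polynomial.C (f.coeff 0) ∈ q'.asIdeal :=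
      (Ideal.add_mem_iff_right _ (q'.asIdeal.mul_mem_left _ (hqq'.le hX))).mp hf
    exact q.asIdeal.add_mem (q.asIdeal.mul_mem_left _ hX) (hle hC))
  refine h3.mono (sup_le ?_ fun f hf => ?_) ?_
  · rw [Ideal.map_le_iff_le_comap]
    intro b hb
    exact C_algebraMap_mem q hb
  · refine Ideal.mem_comap.mpr (Ideal.mem_sup_left (mem_extendedIdeal.mpr fun m => ?_))
    rw [toExtended_C, toLaurent_apply]
    rw [mem_coeffIdeal] at hf
    by_cases hm : ∃ n : ℕ, (n : ℤ) = m
    · obtain ⟨n, rfl⟩ := hm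
      have : (AddMonoidAlgebra.mapDomain (Nat.cast : ℕ → ℤ) f.1.toFinsupp).coeff (n : ℤ) =
        f.1.coeff n := Finsupp.mapDomain_apply Nat.cast_injective _ _
      rw [this]
      exact hf n
    · have : (AddMonoidAlgebra.mapDomain (Nat.cast : ℕ → ℤ) f.1.toFinsupp).coeff m = 0 :=
        Finsupp.mapDomain_of_notMem_range _ _ (fun ⟨n, hn⟩ => hm ⟨n, hn⟩)
      rw [this]
      exact q.zero_mem
  · intro f hf
    change (evalRingHom 0) (Polynomial.C f) ∈ maximalIdealHom I at hf
    rwa [coe_evalRingHom, eval_C] at hf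

/-- The chain of primes above a homogeneous prime may be moved into the homogeneous maximal
ideal. -/
theorem _root_.HasPrimeChain.maximalIdealHom [IsLocalRing A] {Q : Ideal (reesAlgebra I)}
    (hQ : ∀ f ∈ Q, ∀ n, component n f ∈ Q) {n : ℕ}
    {p : PrimeSpectrum (reesAlgebra I)} (h : HasPrimeChain Q n p) :
    HasPrimeChain Q n ⟨reesAlgebra.maximalIdealHom I, inferInstance⟩ := by
  have hle : ∀ P : Ideal (reesAlgebra I), P ≠ ⊤ → (∀ f ∈ P, ∀ n, component n f ∈ P) →
      P ≤ reesAlgebra.maximalIdealHom I := by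
    intro P hP hhom f hf
    rw [mem_maximalIdealHom]
    by_contra hu
    refine hP (Ideal.eq_top_of_isUnit_mem _ (hhom f hf 0) ?_)
    exact (notMem_maximalIdeal.mp hu).map (algebraMap A (reesAlgebra I))
  have hcore : ∀ p : PrimeSpectrum (reesAlgebra I),
      (gradingCoaction I).homogeneousCore p.asIdeal ≤ reesAlgebra.maximalIdealHom I := by
    intro p
    refine hle _ ((gradingCoaction I).isPrime_homogeneousCore p.asIdeal).ne_top fun f hf n => ?_
    rw [← gradingCoaction_component]
    exact (gradingCoaction I).isHomogeneousIdeal_homogeneousCore _ f hf n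
  have hQ' : (gradingCoaction I).IsHomogeneousIdeal Q := fun f hf n => by
    rw [gradingCoaction_component]
    exact hQ f hf n
  obtain _ | n := n
  · exact HasPrimeChain.zero_iff.mpr
      (hle Q (fun ht => p.2.ne_top (top_le_iff.mp (ht ▸ h.le))) hQ)
  · by_cases hpN : p.asIdeal ≤ reesAlgebra.maximalIdealHom I
    · exact h.mono le_rfl hpN
    -- The core of `p` costs one prime, and the homogeneous maximal ideal restores it. The core is
    -- strictly smaller, for otherwise maximality would give `p` equal to that ideal.
    · refine HasPrimeChain.succ_iff.mpr ⟨_, ?_, h.homogeneousCore _ hQ'⟩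
      refine lt_of_le_of_ne (hcore p) fun heq => hpN ?_
      have heq' : (gradingCoaction I).homogeneousCore p.asIdeal = reesAlgebra.maximalIdealHom I :=
        congrArg PrimeSpectrum.asIdeal heq
      have := isMaximal_maximalIdealHom (I := I) |>.eq_of_le p.2.ne_top
        (heq' ▸ (gradingCoaction I).homogeneousCore_le p.asIdeal)
      exact this.ge

end reesAlgebra

/-! ### The associated graded module as a module over the Rees algebra -/

theorem Ideal.IsPrime.comap_annihilator_quotient_le {R N : Type*} [CommRing R] [AddCommGroup N]
    [Module R N] [Module.Finite R N] {K P : Ideal R} [P.IsPrime] (hK : K ≤ P)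
    (hN : Module.annihilator R N ≤ P) :
    (Module.annihilator (R ⧸ K) (QuotientByIdeal R N K)).comap (Ideal.Quotient.mk K) ≤ P := by
  have hmem : (⟨P, inferInstance⟩ : PrimeSpectrum R) ∈
      Module.support R (QuotientByIdeal R N K) := by
    rw [Module.support_quotient]
    exact ⟨Module.mem_support_iff_of_finite.mpr hN, hK⟩
  refine le_trans (fun f hf => ?_) (Module.annihilator_le_of_mem_support hmem)
  exact Module.mem_annihilator.mpr fun y => Module.mem_annihilator.mp hf y

section AnnihilatorIdeals

open Polynomial

variable {A : Type u} [CommRing A] (I : Ideal A) (M : Type v) [AddCommGroup M] [Module A M]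

/-- The ideal of the Rees algebra generated by `I` in degree zero. -/
abbrev reesAlgebra.kerAssocGraded : Ideal (reesAlgebra I) :=
  I.map (algebraMap A (reesAlgebra I))

/-- The projection from the Rees algebra onto the associated graded ring. -/
def AssocGradedRing.mk : reesAlgebra I →+* AssocGradedRing I :=
  Ideal.Quotient.mk (reesAlgebra.kerAssocGraded I)

theorem AssocGradedRing.mk_surjective : Function.Surjective (AssocGradedRing.mk I) :=
  Ideal.Quotient.mk_surjective

/-- The projection from the Rees module onto the associated graded module. -/
def AssocGradedModule.mk : ReesModule I M →+ AssocGradedModule I M :=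
  (QuotientByIdeal.mk (reesAlgebra I) (ReesModule I M)
    (reesAlgebra.kerAssocGraded I)).toAddMonoidHom

theorem AssocGradedModule.mk_surjective : Function.Surjective (AssocGradedModule.mk I M) :=
  Submodule.mkQ_surjective _

theorem AssocGradedModule.mk_smul_mk (f : reesAlgebra I) (x : ReesModule I M) :
    AssocGradedRing.mk I f • AssocGradedModule.mk I M x = AssocGradedModule.mk I M (f • x) := rfl

theorem AssocGradedModule.mk_eq_zero {x : ReesModule I M} : AssocGradedModule.mk I M x = 0 ↔
    x ∈ (reesAlgebra.kerAssocGraded I • ⊤ : Submodule (reesAlgebra I) (ReesModule I M)) :=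
  Submodule.Quotient.mk_eq_zero _

variable {I M} in
theorem ReesModule.coeff_mem (x : ReesModule I M) (n : ℕ) :
    x.1.coeff n ∈ (I ^ n • ⊤ : Submodule A M) := x.2 n

variable {I M} in
/-- The homogeneous element of degree `n` of the Rees module given by `z ∈ Iⁿ M`. -/
def ReesModule.single (n : ℕ) (z : M) (hz : z ∈ (I ^ n • ⊤ : Submodule A M)) : ReesModule I M :=
  ⟨PolynomialModule.single A n z, by
    intro j
    rw [PolynomialModule.coeff_single, Finsupp.single_apply]
    split_ifs with h
    · exact h ▸ hz
    · exact Submodule.zero_mem _⟩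

theorem AssocGradedModule.of_eq_mk (n : ℕ) (z : M) (hz : z ∈ (I ^ n • ⊤ : Submodule A M)) :
    AssocGradedModule.of I n z hz = AssocGradedModule.mk I M (ReesModule.single n z hz) := rfl

theorem ReesModule.sum_single (x : ReesModule I M) :
    ∑ n ∈ x.1.coeff.support, ReesModule.single n (x.1.coeff n) (ReesModule.coeff_mem x n) = x := by
  apply Subtype.ext
  rw [AddSubmonoidClass.coe_finsetSum]
  apply PolynomialModule.coeff_injective
  rw [PolynomialModule.coeff_sum]
  exact x.1.coeff.sum_single

theorem ReesModule.mem_smul_top_iff {x : ReesModule I M} :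
    x ∈ (reesAlgebra.kerAssocGraded I • ⊤ : Submodule (reesAlgebra I) (ReesModule I M)) ↔
      ∀ n, x.1.coeff n ∈ (I ^ (n + 1) • ⊤ : Submodule A M) := by
  constructor
  · intro hx
    let S : Submodule (reesAlgebra I) (ReesModule I M) :=
      ((I.stableFiltration (I • ⊤ : Submodule A M)).submodule).comap
        (Submodule.subtype (ReesModule I M))
    have hS : ∀ y : ReesModule I M, y ∈ S ↔ ∀ n, y.1.coeff n ∈ (I ^ (n + 1) • ⊤ : Submodule A M) := by
      intro y
      change (∀ n, y.1.coeff n ∈ I ^ n • (I • ⊤ : Submodule A M)) ↔ _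
      simp only [← Submodule.mul_smul, ← pow_succ]
    rw [← hS]
    refine (Submodule.smul_le.mpr fun k hk y _ => ?_) hx
    refine Submodule.span_induction (p := fun k _ => k • y ∈ S) ?_ ?_ ?_ ?_ hk
    · rintro _ ⟨b, hb, rfl⟩
      rw [hS]
      intro n
      have h1 : ((algebraMap A (reesAlgebra I) b) • y).1.coeff n = b • y.1.coeff n := by
        change (monomial 0 b • y.1).coeff n = _
        rw [PolynomialModule.monomial_smul_apply, if_pos (Nat.zero_le n), Nat.sub_zero]
      rw [h1, pow_succ', Submodule.mul_smul]
      exact Submodule.smul_mem_smul hb (ReesModule.coeff_mem y n)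
    · rw [zero_smul]
      exact S.zero_mem
    · intro a b _ _ ha hb
      rw [add_smul]
      exact S.add_mem ha hb
    · intro a b _ hb
      rw [smul_assoc]
      exact S.smul_mem a hb
  · intro hx
    rw [← ReesModule.sum_single I M x]
    refine Submodule.sum_mem _ fun n _ => ?_
    have key : ∀ z ∈ I • (I ^ n • ⊤ : Submodule A M), ∃ hz : z ∈ (I ^ n • ⊤ : Submodule A M),
        ReesModule.single n z hz ∈
          (reesAlgebra.kerAssocGraded I • ⊤ : Submodule (reesAlgebra I) (ReesModule I M)) := by
      intro z hz
      refine Submodule.smul_induction_on hz (fun b hb y hy => ?_) ?_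
      · refine ⟨Submodule.smul_mem _ _ hy, ?_⟩
        have : ReesModule.single n (b • y) (Submodule.smul_mem _ _ hy) =
            algebraMap A (reesAlgebra I) b • ReesModule.single n y hy := by
          apply Subtype.ext
          change PolynomialModule.single A n (b • y) =
            monomial 0 b • PolynomialModule.single A n y
          rw [PolynomialModule.monomial_smul_single, zero_add]
        rw [this]
        exact Submodule.smul_mem_smul (Ideal.mem_map_of_mem _ hb) Submodule.mem_top
      · rintro y z ⟨hy, hy'⟩ ⟨hz, hz'⟩
        refine ⟨Submodule.add_mem _ hy hz, ?_⟩
        have : ReesModule.single n (y + z) (Submodule.add_mem _ hy hz) =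
            ReesModule.single n y hy + ReesModule.single n z hz :=
          Subtype.ext (PolynomialModule.single_add _ _ _)
        rw [this]
        exact Submodule.add_mem _ hy' hz'
    have hxn := hx n
    rw [pow_succ', Submodule.mul_smul] at hxn
    exact (key _ hxn).2

/-- The ideal of all `f` in the Rees algebra such that `fₙ J M ⊆ Iⁿ⁺¹ M` for all `n`. -/
def annihilatorIdeal (J : Ideal A) : Ideal (reesAlgebra I) where
  carrier := {f | ∀ n, ∀ z ∈ (J • ⊤ : Submodule A M),
    f.1.coeff n • z ∈ (I ^ (n + 1) • ⊤ : Submodule A M)}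
  add_mem' {f g} hf hg n z hz := by
    rw [Subalgebra.coe_add, coeff_add, add_smul]
    exact Submodule.add_mem _ (hf n z hz) (hg n z hz)
  zero_mem' n z _ := by
    rw [ZeroMemClass.coe_zero, coeff_zero, zero_smul]
    exact Submodule.zero_mem _
  smul_mem' g f hf n z hz := by
    rw [smul_eq_mul, MulMemClass.coe_mul, coeff_mul, Finset.sum_smul]
    refine Submodule.sum_mem _ fun x hx => ?_
    rw [mul_smul, ← Finset.HasAntidiagonal.mem_antidiagonal.mp hx, add_assoc, pow_add,
      Submodule.mul_smul]
    exact Submodule.smul_mem_smul (g.2 x.1) (hf x.2 z hz)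

variable {I M}

theorem mem_annihilatorIdeal {J : Ideal A} {f : reesAlgebra I} : f ∈ annihilatorIdeal I M J ↔
    ∀ n, ∀ z ∈ (J • ⊤ : Submodule A M), f.1.coeff n • z ∈ (I ^ (n + 1) • ⊤ : Submodule A M) :=
  Iff.rfl

theorem annihilatorIdeal_antitone {J J' : Ideal A} (h : J ≤ J') :
    annihilatorIdeal I M J' ≤ annihilatorIdeal I M J :=
  fun _ hf n z hz => hf n z (Submodule.smul_mono_left h hz)

/-- For a prime `Q`, this makes the set of `J` whose ideal is not contained in `Q` closed under
sums. -/
theorem inf_le_annihilatorIdeal_sup {J J' : Ideal A} :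
    annihilatorIdeal I M J ⊓ annihilatorIdeal I M J' ≤ annihilatorIdeal I M (J ⊔ J') := by
  rintro f ⟨hf, hf'⟩ n z hz
  rw [Submodule.sup_smul] at hz
  obtain ⟨y, hy, y', hy', rfl⟩ := Submodule.mem_sup.mp hz
  rw [smul_add]
  exact Submodule.add_mem _ (hf n y hy) (hf' n y' hy')

theorem component_mem_annihilatorIdeal {J : Ideal A} {f : reesAlgebra I}
    (hf : f ∈ annihilatorIdeal I M J) (n : ℕ) : reesAlgebra.component n f ∈ annihilatorIdeal I M J := by
  intro m z hz
  rw [reesAlgebra.coe_component, coeff_monomial]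
  split_ifs with h
  · exact h ▸ hf n z hz
  · rw [zero_smul]
    exact Submodule.zero_mem _

theorem kerAssocGraded_le_annihilatorIdeal (J : Ideal A) :
    reesAlgebra.kerAssocGraded I ≤ annihilatorIdeal I M J := by
  rw [Ideal.map_le_iff_le_comap]
  intro b hb n z _
  change (C b).coeff n • z ∈ _
  rw [coeff_C]
  split_ifs with h
  · subst h
    rw [zero_add, pow_one]
    exact Submodule.smul_mem_smul hb Submodule.mem_top
  · rw [zero_smul]
    exact Submodule.zero_mem _

theorem coeffIdeal_le_annihilatorIdeal (J : Ideal A) :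
    reesAlgebra.coeffIdeal I (Module.annihilator A M) ≤ annihilatorIdeal I M J := by
  intro f hf n z _
  rw [Module.mem_annihilator.mp (reesAlgebra.mem_coeffIdeal.mp hf n) z]
  exact Submodule.zero_mem _

theorem ReesModule.coe_smul_single (f : reesAlgebra I) (k : ℕ) (z : M)
    (hz : z ∈ (I ^ k • ⊤ : Submodule A M)) (n : ℕ) :
    (f • ReesModule.single k z hz).1.coeff n = if k ≤ n then f.1.coeff (n - k) • z else 0 :=
  PolynomialModule.smul_single_apply k f.1 z n

theorem mem_annihilatorIdeal_of_forall_single {J : Ideal A} {f : reesAlgebra I}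
    (h : ∀ z ∈ (J • ⊤ : Submodule A M), ∀ hz : z ∈ (I ^ 0 • ⊤ : Submodule A M),
      AssocGradedRing.mk I f • AssocGradedModule.of I 0 z hz = 0) :
    f ∈ annihilatorIdeal I M J := by
  intro n z hz
  have := h z hz (by simp)
  rw [AssocGradedModule.of_eq_mk, AssocGradedModule.mk_smul_mk, AssocGradedModule.mk_eq_zero,
    ReesModule.mem_smul_top_iff] at this
  have h2 := this n
  rwa [ReesModule.coe_smul_single, if_pos (Nat.zero_le n), Nat.sub_zero] at h2

-- Testing on degree zero suffices, because `J Iᵏ M = Iᵏ (J M)`: the factor from `Iᵏ` raises the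
-- degree of the target by `k`.
variable (I M) in
theorem comap_annihilator_gradedSubmodule (J : Ideal A) :
    (Module.annihilator (AssocGradedRing I) (gradedSubmoduleOfIdeal I M J)).comap
      (AssocGradedRing.mk I) = annihilatorIdeal I M J := by
  ext f
  rw [Ideal.mem_comap, gradedSubmoduleOfIdeal]
  rw [Submodule.mem_annihilator_span]
  constructor
  · intro h
    refine mem_annihilatorIdeal_of_forall_single fun z hz hz0 => ?_
    exact h ⟨_, 0, z, hz0, by simpa using hz, rfl⟩
  · rintro hf ⟨_, k, z, hz, hzJ, rfl⟩
    change AssocGradedRing.mk I f • AssocGradedModule.of I k z hz = 0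
    rw [AssocGradedModule.of_eq_mk, AssocGradedModule.mk_smul_mk, AssocGradedModule.mk_eq_zero,
      ReesModule.mem_smul_top_iff]
    intro n
    rw [ReesModule.coe_smul_single]
    split_ifs with hkn
    · obtain ⟨m, rfl⟩ := Nat.exists_eq_add_of_le hkn
      rw [Nat.add_sub_cancel_left]
      rw [← Submodule.mul_smul, mul_comm, Submodule.mul_smul] at hzJ
      refine Submodule.smul_induction_on hzJ (fun c hc w hw => ?_) fun x y hx hy => ?_
      · rw [smul_comm, add_assoc, pow_add, Submodule.mul_smul]
        exact Submodule.smul_mem_smul hc (hf m w hw)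
      · rw [smul_add]
        exact Submodule.add_mem _ hx hy
    · exact Submodule.zero_mem _

variable (I M) in
theorem comap_annihilator_assocGradedModule :
    (Module.annihilator (AssocGradedRing I) (AssocGradedModule I M)).comap
      (AssocGradedRing.mk I) = annihilatorIdeal I M ⊤ := by
  ext f
  rw [Ideal.mem_comap, Module.mem_annihilator]
  constructor
  · intro h
    exact mem_annihilatorIdeal_of_forall_single fun z _ _ => h _
  · intro hf y
    obtain ⟨x, rfl⟩ := AssocGradedModule.mk_surjective I M y
    rw [AssocGradedModule.mk_smul_mk, AssocGradedModule.mk_eq_zero, ReesModule.mem_smul_top_iff]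
    intro n
    change (f.1 • x.1).coeff n ∈ _
    rw [PolynomialModule.smul_apply]
    refine Submodule.sum_mem _ fun i hi => ?_
    have hx := ReesModule.coeff_mem x i.2
    rw [← Finset.HasAntidiagonal.mem_antidiagonal.mp hi]
    refine Submodule.smul_induction_on hx (fun c hc w _ => ?_) fun x y hx hy => ?_
    · rw [smul_comm, add_comm i.1, add_assoc, pow_add, Submodule.mul_smul]
      exact Submodule.smul_mem_smul hc (hf i.1 w (by simp))
    · rw [smul_add]
      exact Submodule.add_mem _ hx hy

theorem annihilator_reesModule_le : Module.annihilator (reesAlgebra I) (ReesModule I M) ≤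
    reesAlgebra.coeffIdeal I (Module.annihilator A M) := by
  intro f hf
  refine reesAlgebra.mem_coeffIdeal.mpr fun n => Module.mem_annihilator.mpr fun z => ?_
  have hz : z ∈ (I ^ 0 • ⊤ : Submodule A M) := by simp
  have := Module.mem_annihilator.mp hf (ReesModule.single 0 z hz)
  have h2 := ReesModule.coe_smul_single f 0 z hz n
  rw [if_pos (Nat.zero_le n), Nat.sub_zero, this] at h2
  exact h2.symm

section Noetherian

variable [IsNoetherianRing A] [Module.Finite A M]

instance ReesModule.instFinite : Module.Finite (reesAlgebra I) (ReesModule I M) := by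
  rw [Module.Finite.iff_fg]
  refine (Ideal.Filtration.submodule_fg_iff_stable _ fun i => ?_).mpr
    (I.stableFiltration_stable ⊤)
  exact IsNoetherian.noetherian _

instance AssocGradedRing.instIsNoetherianRing : IsNoetherianRing (AssocGradedRing I) :=
  isNoetherianRing_of_surjective _ _ (AssocGradedRing.mk I) (AssocGradedRing.mk_surjective I)

instance AssocGradedModule.instFinite :
    Module.Finite (AssocGradedRing I) (AssocGradedModule I M) := by
  have : RingHomSurjective (AssocGradedRing.mk I) := ⟨AssocGradedRing.mk_surjective I⟩
  let φ : ReesModule I M →ₛₗ[AssocGradedRing.mk I] AssocGradedModule I M :=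
    { AssocGradedModule.mk I M with map_smul' := fun f x => rfl }
  exact Module.Finite.of_surjective φ (AssocGradedModule.mk_surjective I M)

/-- The support of the associated graded module: a prime of the Rees algebra containing `I` and
all polynomials with coefficients in the annihilator of `M` contains the annihilator of `G_I(M)`. -/
theorem annihilatorIdeal_top_le {P : Ideal (reesAlgebra I)} [P.IsPrime]
    (h : reesAlgebra.kerAssocGraded I ⊔ reesAlgebra.coeffIdeal I (Module.annihilator A M) ≤ P) :
    annihilatorIdeal I M ⊤ ≤ P := by
  rw [← comap_annihilator_assocGradedModule]
  exact Ideal.IsPrime.comap_annihilator_quotient_le (R := reesAlgebra I) (N := ReesModule I M)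
    (le_sup_left.trans h) (annihilator_reesModule_le.trans (le_sup_right.trans h))

end Noetherian

end AnnihilatorIdeals

/-! ### Parameters of localized modules -/

section Localization

variable {R G V : Type*} [CommRing R] [CommRing G] [AddCommGroup V] [Module G V]

theorem ringKrullDim_quotient_comap {f : R →+* G} (hf : Function.Surjective f) (Q : Ideal G) :
    ringKrullDim (R ⧸ Q.comap f) = ringKrullDim (G ⧸ Q) := by
  refine ringKrullDim_eq_of_ringEquiv (RingEquiv.ofBijective
    (Ideal.quotientMap Q f le_rfl) ⟨Ideal.quotientMap_injective, ?_⟩)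
  exact Ideal.quotientMap_surjective hf

theorem supportDim_eq_ringKrullDim_quotient_comap [Module.Finite G V] {f : R →+* G}
    (hf : Function.Surjective f) :
    Module.supportDim G V = ringKrullDim (R ⧸ (Module.annihilator G V).comap f) := by
  rw [ringKrullDim_quotient_comap hf, Module.supportDim_eq_ringKrullDim_quotient_annihilator]

variable (𝔫 : Ideal G) [𝔫.IsPrime]

theorem annihilator_le_comap_annihilator_localizedModule : Module.annihilator G V ≤
    (Module.annihilator (Localization.AtPrime 𝔫) (LocalizedModule 𝔫.primeCompl V)).comap
      (algebraMap G (Localization.AtPrime 𝔫)) := by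
  intro g hg
  refine Module.mem_annihilator.mpr fun w => ?_
  induction w using LocalizedModule.induction_on with
  | h m s =>
    rw [algebraMap_smul, LocalizedModule.smul'_mk, Module.mem_annihilator.mp hg,
      LocalizedModule.zero_mk]

theorem annihilator_localizedModule_le_iff [Module.Finite G V]
    {P : PrimeSpectrum (Localization.AtPrime 𝔫)} :
    Module.annihilator (Localization.AtPrime 𝔫) (LocalizedModule 𝔫.primeCompl V) ≤ P.asIdeal ↔
      Module.annihilator G V ≤ P.asIdeal.comap (algebraMap G (Localization.AtPrime 𝔫)) := by
  constructor
  · exact fun h => (annihilator_le_comap_annihilator_localizedModule 𝔫).trans (Ideal.comap_mono h)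
  · intro h l hl
    obtain ⟨g, t, rfl⟩ := IsLocalization.exists_mk'_eq 𝔫.primeCompl l
    have hunit : ∀ s : 𝔫.primeCompl, algebraMap G (Localization.AtPrime 𝔫) s ∉ P.asIdeal :=
      fun s hs => P.2.ne_top (Ideal.eq_top_of_isUnit_mem _ hs (IsLocalization.map_units _ s))
    have hg : algebraMap G (Localization.AtPrime 𝔫) g ∈
        Module.annihilator (Localization.AtPrime 𝔫) (LocalizedModule 𝔫.primeCompl V) := by
      rw [← IsLocalization.mk'_spec (Localization.AtPrime 𝔫) g t]
      exact Ideal.mul_mem_right _ _ hl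
    suffices algebraMap G (Localization.AtPrime 𝔫) g ∈ P.asIdeal by
      rw [← IsLocalization.mk'_spec (Localization.AtPrime 𝔫) g t] at this
      exact (P.2.mem_or_mem this).resolve_right (hunit t)
    by_contra hgP
    obtain ⟨m, hm⟩ := Module.mem_support_iff'.mp (Module.mem_support_iff_of_finite.mpr
      (show Module.annihilator G V ≤
        (PrimeSpectrum.comap (algebraMap G (Localization.AtPrime 𝔫)) P).asIdeal from h))
    have h0 := Module.mem_annihilator.mp hg (LocalizedModule.mk m 1)
    rw [algebraMap_smul, LocalizedModule.smul'_mk, ← LocalizedModule.zero_mk 1,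
      LocalizedModule.mk_eq] at h0
    obtain ⟨u, hu⟩ := h0
    refine hm (u.1 * g) (fun hmem => ?_) ?_
    · change algebraMap G (Localization.AtPrime 𝔫) (u.1 * g) ∈ P.asIdeal at hmem
      rw [map_mul] at hmem
      exact (P.2.mem_or_mem hmem).elim (hunit u) hgP
    · simpa [Submonoid.smul_def, mul_smul] using hu

variable {f : R →+* G} (hf : Function.Surjective f)

theorem comap_closedPoint_localization :
    PrimeSpectrum.comap ((algebraMap G (Localization.AtPrime 𝔫)).comp f)
      (closedPoint (Localization.AtPrime 𝔫)) =
        PrimeSpectrum.comap f ⟨𝔫, inferInstance⟩ := by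
  apply PrimeSpectrum.ext
  change ((maximalIdeal (Localization.AtPrime 𝔫)).comap (algebraMap G _)).comap f = _
  exact congrArg (Ideal.comap f) (IsLocalization.AtPrime.under_maximalIdeal _ 𝔫)

include hf

theorem comap_localization_le_iff {q q' : PrimeSpectrum (Localization.AtPrime 𝔫)}
    (h : PrimeSpectrum.comap ((algebraMap G (Localization.AtPrime 𝔫)).comp f) q ≤
      PrimeSpectrum.comap ((algebraMap G (Localization.AtPrime 𝔫)).comp f) q') : q ≤ q' := by
  have h1 : q.asIdeal.comap (algebraMap G (Localization.AtPrime 𝔫)) ≤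
      q'.asIdeal.comap (algebraMap G (Localization.AtPrime 𝔫)) :=
    (Ideal.comap_le_comap_iff_of_surjective f hf _ _).mp h
  exact (IsLocalization.orderEmbedding 𝔫.primeCompl (Localization.AtPrime 𝔫)).le_iff_le.mp h1

theorem exists_comap_localization_eq {q : PrimeSpectrum R} (hq : RingHom.ker f ≤ q.asIdeal)
    (hqn : q ≤ PrimeSpectrum.comap f ⟨𝔫, inferInstance⟩) :
    ∃ q', PrimeSpectrum.comap ((algebraMap G (Localization.AtPrime 𝔫)).comp f) q' = q := by
  have hqm : (q.asIdeal.map f).IsPrime := Ideal.map_isPrime_of_surjective hf hq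
  have hcm : (q.asIdeal.map f).comap f = q.asIdeal := by
    rw [Ideal.comap_map_of_surjective f hf]
    exact sup_eq_left.mpr hq
  have hle : q.asIdeal.map f ≤ 𝔫 := Ideal.map_le_iff_le_comap.mpr hqn
  have hmem : (⟨q.asIdeal.map f, hqm⟩ : PrimeSpectrum G) ∈
      Set.range (PrimeSpectrum.comap (algebraMap G (Localization.AtPrime 𝔫))) := by
    rw [PrimeSpectrum.localization_comap_range _ 𝔫.primeCompl]
    exact Set.disjoint_left.mpr fun x hx hx' => hx (hle hx')
  obtain ⟨q', hq'⟩ := hmem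
  refine ⟨q', ?_⟩
  rw [PrimeSpectrum.comap_comp_apply, hq']
  exact PrimeSpectrum.ext hcm

/-- Transports the criterion by primes of maximal dimension from the local ring `G_𝔫` to `R`. The
bounds `hU` and `hL` force the localized module to have dimension exactly `d`. -/
theorem isPartOfSystemOfParametersAt_iff [IsNoetherianRing G] [Module.Finite G V] {d : ℕ}
    (hU : ringKrullDim (R ⧸ (Module.annihilator G V).comap f) ≤ d)
    (hL : HasPrimeChain ((Module.annihilator G V).comap f) d
      (PrimeSpectrum.comap f ⟨𝔫, inferInstance⟩)) {r : R} :
    IsPartOfSystemOfParametersAt 𝔫 V (f r) ↔ f r ∈ 𝔫 ∧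
      ∀ Q : PrimeSpectrum R, (Module.annihilator G V).comap f ≤ Q.asIdeal →
        HasPrimeChain Q.asIdeal d (PrimeSpectrum.comap f ⟨𝔫, inferInstance⟩) → r ∉ Q.asIdeal := by
  have hker : RingHom.ker f ≤ (Module.annihilator G V).comap f := Ideal.comap_mono bot_le
  have hinj := fun q q' => comap_localization_le_iff 𝔫 hf (q := q) (q' := q')
  have hstrict : ∀ q q' : PrimeSpectrum (Localization.AtPrime 𝔫), q < q' →
      PrimeSpectrum.comap ((algebraMap G (Localization.AtPrime 𝔫)).comp f) q <
        PrimeSpectrum.comap ((algebraMap G (Localization.AtPrime 𝔫)).comp f) q' :=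
    fun q q' h => lt_of_le_not_ge (Ideal.comap_mono h.le) fun h' => h.not_ge (hinj _ _ h')
  have hsur : ∀ q : PrimeSpectrum R, RingHom.ker f ≤ q.asIdeal →
      q ≤ PrimeSpectrum.comap f ⟨𝔫, inferInstance⟩ → ∃ q',
        PrimeSpectrum.comap ((algebraMap G (Localization.AtPrime 𝔫)).comp f) q' = q :=
    fun q => exists_comap_localization_eq 𝔫 hf
  have hann : ∀ q : PrimeSpectrum (Localization.AtPrime 𝔫),
      (Module.annihilator G V).comap f ≤
        q.asIdeal.comap ((algebraMap G (Localization.AtPrime 𝔫)).comp f) ↔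
      Module.annihilator (Localization.AtPrime 𝔫) (LocalizedModule 𝔫.primeCompl V) ≤
        q.asIdeal := by
    intro q
    rw [annihilator_localizedModule_le_iff, ← Ideal.comap_comap,
      Ideal.comap_le_comap_iff_of_surjective f hf]
  have hcl := comap_closedPoint_localization 𝔫 (f := f)
  have hdim : Module.supportDim (Localization.AtPrime 𝔫) (LocalizedModule 𝔫.primeCompl V) = d := by
    rw [Module.supportDim_eq_ringKrullDim_quotient_annihilator]
    refine le_antisymm (ringKrullDim_quotient_le_iff.mpr fun n p h => ?_) ?_
    · refine ((h.comap ((algebraMap G (Localization.AtPrime 𝔫)).comp f)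
        fun q q' _ => hstrict q q').mono ?_ le_rfl).le_of_ringKrullDim_le hU
      rw [← Ideal.comap_comap]
      exact Ideal.comap_mono (annihilator_le_comap_annihilator_localizedModule 𝔫)
    · rw [← hcl] at hL
      exact (hL.of_comap (Q' := Module.annihilator (Localization.AtPrime 𝔫)
        (LocalizedModule 𝔫.primeCompl V)) _ hinj
        (fun q hq hqn => hsur q (hker.trans hq) hqn) (fun q => (hann q).mp)
        hcl.le).le_ringKrullDim
  rw [IsPartOfSystemOfParametersAt, isPartOfSystemOfParameters_iff hdim]
  refine and_congr ?_ ⟨fun h Q hQ hc => ?_, fun h P hP hc => ?_⟩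
  · exact IsLocalization.AtPrime.to_map_mem_maximal_iff _ 𝔫 _
  · obtain ⟨P, rfl⟩ := hsur Q (hker.trans hQ) hc.le
    refine h P (Module.mem_support_iff_of_finite.mpr ((hann P).mp hQ)) ?_
    rw [← hcl] at hc
    exact hc.of_comap _ hinj (fun q hq hqn => hsur q (hker.trans (hQ.trans hq)) hqn)
      (fun q hq => hinj P q hq) hcl.le
  · refine h (PrimeSpectrum.comap ((algebraMap G (Localization.AtPrime 𝔫)).comp f) P)
      ((hann P).mpr (Module.mem_support_iff_of_finite.mp hP)) ?_
    rw [← hcl]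
    exact hc.comap _ fun q q' _ => hstrict q q'

end Localization

/-! ### Homogeneous prime avoidance -/

section Avoidance

open Polynomial

variable {A : Type u} [CommRing A] {I : Ideal A}

theorem reesAlgebra.exists_homogeneous_notMem {K Q : Ideal (reesAlgebra I)}
    (hK : ∀ f ∈ K, ∀ n, reesAlgebra.component n f ∈ K) (hKQ : ¬ K ≤ Q) :
    ∃ (n : ℕ) (x : A) (f : reesAlgebra I), f.1 = monomial n x ∧ f ∈ K ∧ f ∉ Q := by
  obtain ⟨f, hfK, hfQ⟩ := SetLike.not_le_iff_exists.mp hKQ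
  have : ∃ n, reesAlgebra.component n f ∉ Q := by
    by_contra! h
    exact hfQ (reesAlgebra.sum_component f ▸ Q.sum_mem fun n _ => h n)
  obtain ⟨n, hn⟩ := this
  exact ⟨n, _, _, reesAlgebra.coe_component n f, hK f hfK n, hn⟩

/-- Homogeneous prime avoidance in the Rees algebra: a homogeneous ideal contained in none of
finitely many pairwise incomparable relevant homogeneous primes contains a homogeneous element of
positive degree lying in none of them. -/
theorem reesAlgebra.exists_homogeneous_forall_notMem (T : Finset (Ideal (reesAlgebra I)))
    (hprime : ∀ Q ∈ T, Q.IsPrime) (hanti : ∀ Q ∈ T, ∀ Q' ∈ T, Q ≤ Q' → Q = Q')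
    (hhom : ∀ Q ∈ T, ∀ f ∈ Q, ∀ n, reesAlgebra.component n f ∈ Q)
    (hrel : ∀ Q ∈ T, ∃ n, 1 ≤ n ∧ ∃ f, reesAlgebra.component n f ∉ Q)
    {𝔠 : Ideal (reesAlgebra I)} (h𝔠 : ∀ f ∈ 𝔠, ∀ n, reesAlgebra.component n f ∈ 𝔠)
    (hle : ∀ Q ∈ T, ¬ 𝔠 ≤ Q) :
    ∃ (n : ℕ) (x : A) (f : reesAlgebra I),
      1 ≤ n ∧ f.1 = monomial n x ∧ f ∈ 𝔠 ∧ ∀ Q ∈ T, f ∉ Q := by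
  classical
  have key : ∀ Q ∈ T, ∃ (n : ℕ) (x : A) (f : reesAlgebra I), 1 ≤ n ∧ f.1 = monomial n x ∧
      f ∈ 𝔠 ∧ f ∉ Q ∧ ∀ Q' ∈ T, Q' ≠ Q → f ∈ Q' := by
    intro Q hQ
    have := hprime Q hQ
    have hK : ∀ f ∈ 𝔠 ⊓ (T.erase Q).inf id, ∀ n,
        reesAlgebra.component n f ∈ 𝔠 ⊓ (T.erase Q).inf id := by
      rintro f ⟨hf, hf'⟩ n
      refine ⟨h𝔠 f hf n, ?_⟩
      rw [SetLike.mem_coe, Submodule.mem_finsetInf] at hf' ⊢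
      exact fun Q' hQ' => hhom Q' (Finset.mem_of_mem_erase hQ') f (hf' Q' hQ') n
    have hKQ : ¬ 𝔠 ⊓ (T.erase Q).inf id ≤ Q := by
      rw [Ideal.IsPrime.inf_le this, not_or]
      refine ⟨hle Q hQ, fun h => ?_⟩
      obtain ⟨Q', hQ', hQQ'⟩ := (Ideal.IsPrime.inf_le' this).mp h
      exact Finset.ne_of_mem_erase hQ' (hanti Q' (Finset.mem_of_mem_erase hQ') Q hQ hQQ')
    obtain ⟨n, x, f, hfx, hfK, hfQ⟩ := reesAlgebra.exists_homogeneous_notMem hK hKQ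
    -- Multiplying by a component of positive degree outside `Q` makes the degree of the chosen
    -- element positive.
    obtain ⟨k, hk, g, hg⟩ := hrel Q hQ
    refine ⟨n + k, x * g.1.coeff k, f * reesAlgebra.component k g, by omega, ?_,
      Ideal.mul_mem_right _ _ hfK.1, fun h => (this.mem_or_mem h).elim hfQ hg, ?_⟩
    · rw [MulMemClass.coe_mul, hfx, reesAlgebra.coe_component, monomial_mul_monomial]
    · intro Q' hQ' hne
      refine Ideal.mul_mem_right _ _ ?_
      exact (Submodule.mem_finsetInf.mp hfK.2) Q' (Finset.mem_erase.mpr ⟨hne, hQ'⟩)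
  choose! n x f hn hfx hf𝔠 hfQ hfQ' using key
  -- Raising to complementary powers gives all the chosen elements the common degree `∏ n P`, so
  -- their sum is homogeneous. Modulo each `Q` only one summand survives.
  have hm : ∀ Q ∈ T, n Q * ((∏ P ∈ T, n P) / n Q) = ∏ P ∈ T, n P :=
    fun Q hQ => Nat.mul_div_cancel' (Finset.dvd_prod_of_mem n hQ)
  have hpos : 1 ≤ ∏ P ∈ T, n P := Nat.succ_le_of_lt (Finset.prod_pos fun Q hQ => hn Q hQ)
  have he : ∀ Q ∈ T, (∏ P ∈ T, n P) / n Q ≠ 0 := fun Q hQ h => by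
    have := hm Q hQ
    rw [h] at this
    omega
  refine ⟨∏ P ∈ T, n P, ∑ Q ∈ T, x Q ^ ((∏ P ∈ T, n P) / n Q),
    ∑ Q ∈ T, f Q ^ ((∏ P ∈ T, n P) / n Q), hpos, ?_, ?_, ?_⟩
  · rw [AddSubmonoidClass.coe_finsetSum, map_sum]
    refine Finset.sum_congr rfl fun Q hQ => ?_
    rw [SubmonoidClass.coe_pow, hfx Q hQ, monomial_pow, hm Q hQ]
  · exact 𝔠.sum_mem fun Q hQ => 𝔠.pow_mem_of_mem (hf𝔠 Q hQ) _ (Nat.pos_of_ne_zero (he Q hQ))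
  · intro Q hQ hmem
    rw [← Finset.add_sum_erase _ _ hQ] at hmem
    have := hprime Q hQ
    refine hfQ Q hQ (this.mem_of_pow_mem _ ((Ideal.add_mem_iff_left Q ?_).mp hmem))
    refine Q.sum_mem fun Q' hQ' => ?_
    obtain ⟨hne, hQ'T⟩ := Finset.mem_erase.mp hQ'
    exact Q.pow_mem_of_mem (hfQ' Q' hQ'T Q hQ hne.symm) _ (Nat.pos_of_ne_zero (he Q' hQ'T))

end Avoidance

/-! ### The associated graded module and its primes of maximal dimension -/

section TopPrimes

open Polynomial

variable {A : Type u} [CommRing A] {I : Ideal A} {M : Type v} [AddCommGroup M] [Module A M]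
  {d : ℕ}

/-- The bridge between the colon ideals of the definition and the annihilators in the Rees algebra.
-/
theorem monomial_mem_annihilatorIdeal {n : ℕ} {a : A} (ha : a ∈ I ^ n) {J : Ideal A} :
    (⟨monomial n a, reesAlgebra.monomial_mem.mpr ha⟩ : reesAlgebra I) ∈ annihilatorIdeal I M J ↔
      J ≤ (I ^ (n + 1) • ⊤ : Submodule A M).colon
        ((Ideal.span {a} • ⊤ : Submodule A M) : Set M) := by
  rw [mem_annihilatorIdeal]
  constructor
  · intro h r hr
    refine Submodule.mem_colon.mpr fun z hz => ?_
    refine Submodule.smul_induction_on (SetLike.mem_coe.mp hz) (fun c hc w _ => ?_)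
      fun x y hx hy => ?_
    · obtain ⟨b, rfl⟩ := Ideal.mem_span_singleton'.mp hc
      have := h n (r • b • w) (Submodule.smul_mem_smul hr Submodule.mem_top)
      rw [coeff_monomial, if_pos rfl] at this
      rwa [mul_comm b a, mul_smul, smul_comm r a]
    · rw [smul_add]
      exact Submodule.add_mem _ hx hy
  · intro h k z hz
    rw [coeff_monomial]
    split_ifs with hk
    · subst hk
      refine Submodule.smul_induction_on hz (fun r hr w _ => ?_) fun x y hx hy => ?_
      · rw [smul_comm]
        exact Submodule.mem_colon.mp (h hr) _
          (Submodule.smul_mem_smul (Ideal.mem_span_singleton_self a) Submodule.mem_top)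
      · rw [smul_add]
        exact Submodule.add_mem _ hx hy
    · rw [zero_smul]
      exact Submodule.zero_mem _

-- A maximal `J` with the property exists by Noetherianity. It is the greatest one because the
-- property passes to sums, the members of `X` being prime, and to smaller ideals.
variable (I M) in
theorem exists_forall_not_annihilatorIdeal_le_iff [IsNoetherianRing A]
    (X : Set (PrimeSpectrum (reesAlgebra I))) :
    ∃ J₀ : Ideal A, ∀ J : Ideal A,
      (∀ Q ∈ X, ¬ annihilatorIdeal I M J ≤ Q.asIdeal) ↔ J ≤ J₀ := by
  let T : Set (Ideal A) := {J | ∀ Q ∈ X, ¬ annihilatorIdeal I M J ≤ Q.asIdeal}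
  have hbot : (⊥ : Ideal A) ∈ T := by
    intro Q _ hle
    refine Q.2.ne_top ((Ideal.eq_top_iff_one _).mpr (hle fun n z hz => ?_))
    rw [Submodule.bot_smul, Submodule.mem_bot] at hz
    rw [hz, smul_zero]
    exact Submodule.zero_mem _
  obtain ⟨J₀, hJ₀, hmax⟩ := set_has_maximal_iff_noetherian.mpr
    (inferInstanceAs (IsNoetherian A A)) T ⟨⊥, hbot⟩
  refine ⟨J₀, fun J => ⟨fun hJ => ?_, fun hle Q hQ h => ?_⟩⟩
  · by_contra hle
    refine hmax (J₀ ⊔ J) (fun Q hQ h => ?_) (left_lt_sup.mpr hle)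
    exact ((Q.2.inf_le).mp (inf_le_annihilatorIdeal_sup.trans h)).elim (hJ₀ Q hQ) (hJ Q hQ)
  · exact hJ₀ Q hQ ((annihilatorIdeal_antitone hle).trans h)

section Local

variable [IsLocalRing A]

variable (I M d) in
/-- The primes `Q` of the Rees algebra in the support of `G_I(M)` with `dim R/Q ≥ d`. -/
def topPrimes : Set (PrimeSpectrum (reesAlgebra I)) :=
  {Q | annihilatorIdeal I M ⊤ ≤ Q.asIdeal ∧
    HasPrimeChain Q.asIdeal d ⟨reesAlgebra.maximalIdealHom I, inferInstance⟩}

theorem comap_mk_homogeneousMaximalIdeal (hI : I ≠ ⊤) :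
    (AssocGradedRing.homogeneousMaximalIdeal I).comap (AssocGradedRing.mk I) =
      reesAlgebra.maximalIdealHom I := by
  ext f
  have h : f ∈ (AssocGradedRing.homogeneousMaximalIdeal I).comap (AssocGradedRing.mk I) ↔
      f.1.coeff 0 ∈ ((maximalIdeal A).map (Ideal.Quotient.mk I)).comap (Ideal.Quotient.mk I) :=
    Iff.rfl
  rw [h, Ideal.comap_map_of_surjective _ Ideal.Quotient.mk_surjective, ← RingHom.ker_eq_comap_bot,
    Ideal.mk_ker, sup_eq_left.mpr (le_maximalIdeal hI), reesAlgebra.mem_maximalIdealHom]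

/-- Otherwise the chain of length `d` above `Q` would contract to a chain of the same length in the
support of `M/IM`, against `dim M/IM < d`. -/
theorem exists_component_notMem_of_mem_topPrimes [Module.Finite A M]
    (hd : Module.supportDim A M = d)
    (hdim : Module.supportDim A (M ⧸ (I • ⊤ : Submodule A M)) < Module.supportDim A M)
    {Q : PrimeSpectrum (reesAlgebra I)} (hQ : Q ∈ topPrimes I M d) :
    ∃ n, 1 ≤ n ∧ ∃ f, reesAlgebra.component n f ∉ Q.asIdeal := by
  by_contra! hcon
  have hc := reesAlgebra.hasPrimeChain_comap_of_irrelevant_le hcon hQ.2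
  have hmem : PrimeSpectrum.comap (algebraMap A (reesAlgebra I)) Q ∈
      Module.support A (M ⧸ (I • ⊤ : Submodule A M)) := by
    rw [Module.support_quotient]
    refine ⟨Module.mem_support_iff_of_finite.mpr fun a ha => hQ.1 ?_, fun a ha => hQ.1 ?_⟩
    · refine coeffIdeal_le_annihilatorIdeal ⊤ (reesAlgebra.mem_coeffIdeal.mpr fun n => ?_)
      change (C a).coeff n ∈ _
      rw [coeff_C]
      split_ifs
      · exact ha
      · exact Ideal.zero_mem _
    · exact kerAssocGraded_le_annihilatorIdeal ⊤ (Ideal.mem_map_of_mem _ ha)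
  have hle := (hc.mono (Module.annihilator_le_of_mem_support hmem) le_rfl).le_ringKrullDim
  rw [← Module.supportDim_eq_ringKrullDim_quotient_annihilator, ← hd] at hle
  exact hle.not_gt hdim

end Local

variable [IsNoetherianRing A] [Module.Finite A M]

variable (I M) in
theorem supportDim_assocGradedModule_eq :
    Module.supportDim (AssocGradedRing I) (AssocGradedModule I M) =
      ringKrullDim (reesAlgebra I ⧸ annihilatorIdeal I M ⊤) := by
  rw [supportDim_eq_ringKrullDim_quotient_comap (AssocGradedRing.mk_surjective I),
    comap_annihilator_assocGradedModule]

variable (I M) in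
theorem supportDim_gradedSubmoduleOfIdeal_eq (J : Ideal A) :
    Module.supportDim (AssocGradedRing I) (gradedSubmoduleOfIdeal I M J) =
      ringKrullDim (reesAlgebra I ⧸ annihilatorIdeal I M J) := by
  rw [supportDim_eq_ringKrullDim_quotient_comap (AssocGradedRing.mk_surjective I),
    comap_annihilator_gradedSubmodule]

theorem ringKrullDim_quotient_annihilatorIdeal_le (hd : Module.supportDim A M = d) (J : Ideal A) :
    ringKrullDim (reesAlgebra I ⧸ annihilatorIdeal I M J) ≤ d := by
  have h : reesAlgebra.kerAssocGraded I ⊔ reesAlgebra.coeffIdeal I (Module.annihilator A M) ≤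
      annihilatorIdeal I M J :=
    sup_le (kerAssocGraded_le_annihilatorIdeal J) (coeffIdeal_le_annihilatorIdeal J)
  refine le_trans (ringKrullDim_le_of_surjective (Ideal.Quotient.factor h)
    (Ideal.Quotient.factor_surjective h)) (reesAlgebra.ringKrullDim_quotient_sup_le _ ?_)
  rw [← Module.supportDim_eq_ringKrullDim_quotient_annihilator, hd]

theorem annihilatorIdeal_top_not_lt (hd : Module.supportDim A M = d)
    {P Q p : PrimeSpectrum (reesAlgebra I)} (hP : annihilatorIdeal I M ⊤ ≤ P.asIdeal)
    (h : HasPrimeChain Q.asIdeal d p) : ¬ P.asIdeal < Q.asIdeal := by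
  intro hlt
  have := ((h.cons hlt).mono hP le_rfl).le_of_ringKrullDim_le
    (ringKrullDim_quotient_annihilatorIdeal_le hd ⊤)
  omega

/-- The core of `Q` still contains the homogeneous ideal `annihilatorIdeal I M ⊤`. Were it smaller
than `Q`, the chain could be extended to length `d + 1`. -/
theorem component_mem_of_hasPrimeChain (hd : Module.supportDim A M = d)
    {Q p : PrimeSpectrum (reesAlgebra I)} (hQ : annihilatorIdeal I M ⊤ ≤ Q.asIdeal)
    (h : HasPrimeChain Q.asIdeal d p) :
    ∀ f ∈ Q.asIdeal, ∀ n, reesAlgebra.component n f ∈ Q.asIdeal := by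
  have hhom : (reesAlgebra.gradingCoaction I).IsHomogeneousIdeal (annihilatorIdeal I M ⊤) := by
    intro f hf n
    rw [reesAlgebra.gradingCoaction_component]
    exact component_mem_annihilatorIdeal hf n
  have hcore : (reesAlgebra.gradingCoaction I).homogeneousCore Q.asIdeal = Q.asIdeal := by
    by_contra hne
    exact annihilatorIdeal_top_not_lt hd
      (P := ⟨(reesAlgebra.gradingCoaction I).homogeneousCore Q.asIdeal, inferInstance⟩)
      (hhom.le_homogeneousCore hQ) h
      (lt_of_le_of_ne ((reesAlgebra.gradingCoaction I).homogeneousCore_le _) hne)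
  intro f hf n
  rw [← hcore] at hf
  rw [← reesAlgebra.gradingCoaction_component]
  exact (reesAlgebra.gradingCoaction I).mem_homogeneousCore.mp hf n

variable [IsLocalRing A]

theorem hasPrimeChain_annihilatorIdeal_top (hI : I ≠ ⊤) (hd : Module.supportDim A M = d) :
    HasPrimeChain (annihilatorIdeal I M ⊤) d ⟨reesAlgebra.maximalIdealHom I, inferInstance⟩ := by
  rw [Module.supportDim_eq_ringKrullDim_quotient_annihilator] at hd
  obtain ⟨P, hP, h⟩ := (reesAlgebra.hasPrimeChain_maximalIdealHom (le_maximalIdeal hI)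
    (hasPrimeChain_closedPoint hd.ge)).exists_prime
  exact h.mono (annihilatorIdeal_top_le hP) le_rfl

theorem supportDim_assocGradedModule (hI : I ≠ ⊤) (hd : Module.supportDim A M = d) :
    Module.supportDim (AssocGradedRing I) (AssocGradedModule I M) = d := by
  rw [supportDim_assocGradedModule_eq]
  exact le_antisymm (ringKrullDim_quotient_annihilatorIdeal_le hd ⊤)
    (hasPrimeChain_annihilatorIdeal_top hI hd).le_ringKrullDim

theorem mem_topPrimes_of_hasPrimeChain (hd : Module.supportDim A M = d)
    {Q p : PrimeSpectrum (reesAlgebra I)} (hQ : annihilatorIdeal I M ⊤ ≤ Q.asIdeal)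
    (h : HasPrimeChain Q.asIdeal d p) : Q ∈ topPrimes I M d :=
  ⟨hQ, HasPrimeChain.maximalIdealHom (component_mem_of_hasPrimeChain hd hQ h) h⟩

theorem topPrimes_nonempty (hI : I ≠ ⊤) (hd : Module.supportDim A M = d) :
    (topPrimes I M d).Nonempty := by
  obtain ⟨P, hP, h⟩ := (hasPrimeChain_annihilatorIdeal_top hI hd).exists_prime
  exact ⟨P, hP, h⟩

theorem eq_of_mem_topPrimes_of_le (hd : Module.supportDim A M = d)
    {Q P : PrimeSpectrum (reesAlgebra I)} (hQ : Q ∈ topPrimes I M d)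
    (hP : annihilatorIdeal I M ⊤ ≤ P.asIdeal) (h : P.asIdeal ≤ Q.asIdeal) :
    P.asIdeal = Q.asIdeal :=
  eq_of_le_of_not_lt h (annihilatorIdeal_top_not_lt hd hP hQ.2)

theorem finite_image_topPrimes (hd : Module.supportDim A M = d) :
    (PrimeSpectrum.asIdeal '' topPrimes I M d).Finite := by
  refine (Ideal.finite_minimalPrimes_of_isNoetherianRing _ (annihilatorIdeal I M ⊤)).subset ?_
  rintro _ ⟨Q, hQ, rfl⟩
  exact ⟨⟨Q.2, hQ.1⟩, fun P hP hPQ => (eq_of_mem_topPrimes_of_le hd (P := ⟨P, hP.1⟩) hQ hP.2 hPQ).ge⟩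

theorem supportDim_gradedSubmoduleOfIdeal_lt_iff (hd : Module.supportDim A M = d) {J : Ideal A} :
    Module.supportDim (AssocGradedRing I) (gradedSubmoduleOfIdeal I M J) < d ↔
      ∀ Q ∈ topPrimes I M d, ¬ annihilatorIdeal I M J ≤ Q.asIdeal := by
  rw [supportDim_gradedSubmoduleOfIdeal_eq]
  constructor
  · intro h Q hQ hle
    exact (hQ.2.mono hle le_rfl).le_ringKrullDim.not_gt h
  · intro h
    by_contra hlt
    obtain ⟨p, hp⟩ := HasPrimeChain.of_le_ringKrullDim (not_lt.mp hlt)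
    obtain ⟨Q, hQ, hc⟩ := hp.exists_prime
    exact h Q (mem_topPrimes_of_hasPrimeChain hd
      ((annihilatorIdeal_antitone le_top).trans hQ) hc) hQ

theorem isPartOfSystemOfParametersGraded_iff (hI : I ≠ ⊤) (hd : Module.supportDim A M = d)
    {n : ℕ} (hn : 1 ≤ n) {a : A} (ha : a ∈ I ^ n) :
    IsPartOfSystemOfParametersGraded I M (AssocGradedRing.of I n a ha) ↔
      ∀ Q ∈ topPrimes I M d,
        (⟨monomial n a, reesAlgebra.monomial_mem.mpr ha⟩ : reesAlgebra I) ∉ Q.asIdeal := by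
  have hprime := AssocGradedRing.isPrime_homogeneousMaximalIdeal I hI
  have hN : PrimeSpectrum.comap (AssocGradedRing.mk I)
      ⟨AssocGradedRing.homogeneousMaximalIdeal I, hprime⟩ =
        ⟨reesAlgebra.maximalIdealHom I, inferInstance⟩ :=
    PrimeSpectrum.ext (comap_mk_homogeneousMaximalIdeal hI)
  have hiff := isPartOfSystemOfParametersAt_iff (AssocGradedRing.homogeneousMaximalIdeal I)
    (AssocGradedRing.mk_surjective I) (V := AssocGradedModule I M) (d := d)
    (by
      rw [comap_annihilator_assocGradedModule]
      exact ringKrullDim_quotient_annihilatorIdeal_le hd ⊤)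
    (by
      rw [comap_annihilator_assocGradedModule, hN]
      exact hasPrimeChain_annihilatorIdeal_top hI hd)
    (r := ⟨monomial n a, reesAlgebra.monomial_mem.mpr ha⟩)
  rw [comap_annihilator_assocGradedModule, hN] at hiff
  have hmem : AssocGradedRing.mk I ⟨monomial n a, reesAlgebra.monomial_mem.mpr ha⟩ ∈
      AssocGradedRing.homogeneousMaximalIdeal I := by
    rw [← Ideal.mem_comap, comap_mk_homogeneousMaximalIdeal hI, reesAlgebra.mem_maximalIdealHom,
      coeff_monomial, if_neg (by omega)]
    exact Ideal.zero_mem _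
  constructor
  · rintro ⟨_, h⟩ Q hQ
    exact (hiff.mp h).2 Q hQ.1 hQ.2
  · exact fun h => ⟨hprime, hiff.mpr ⟨hmem, fun Q hQ hc => h Q ⟨hQ, hc⟩⟩⟩

end TopPrimes

/-! ### The main theorem -/

theorem mainTheorem7 {A : Type u} [CommRing A] [IsLocalRing A] [IsNoetherianRing A]
    {M : Type v} [AddCommGroup M] [Module A M] [Module.Finite A M]
    (hM : IsFormallyEquidimensionalModule A M) (I : Ideal A) (hI : I ≠ ⊤)
    (hdim : Module.supportDim A (M ⧸ (I • ⊤ : Submodule A M)) < Module.supportDim A M) :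
    (∃ (m : ℕ) (x : A) (hx : x ∈ I ^ m), 1 ≤ m ∧ x ∉ I ^ (m + 1) ∧
      IsPartOfSystemOfParametersGraded I M (AssocGradedRing.of I m x hx) ∧
      firstCoefficientIdeal I M =
        ((I ^ (m + 1) • ⊤ : Submodule A M).colon
          ((Ideal.span {x} • ⊤ : Submodule A M) : Set M) : Set A)) ∧
    Module.supportDim (AssocGradedRing I) (AssocGradedModule I M) = Module.supportDim A M ∧
    ∀ J : Ideal A, I ≤ J →
      ((J : Set A) ⊆ firstCoefficientIdeal I M ↔
        Module.supportDim (AssocGradedRing I) (gradedSubmoduleOfIdeal I M J) <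
          Module.supportDim A M) := by
  obtain ⟨d, hd⟩ : ∃ d : ℕ, Module.supportDim A M = d := by
    have hbot : Module.supportDim A M ≠ ⊥ := (bot_le.trans_lt hdim).ne'
    have htop : Module.supportDim A M ≠ ⊤ := fun h =>
      ringKrullDim_ne_top (R := A) (top_le_iff.mp (h ▸ Module.supportDim_le_ringKrullDim A M))
    obtain ⟨e, he⟩ := WithBot.ne_bot_iff_exists.mp hbot
    rw [← he] at htop
    obtain ⟨k, rfl⟩ := ENat.ne_top_iff_exists.mp (fun h : e = ⊤ => htop (by rw [h]; rfl))
    exact ⟨k, he.symm⟩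
  obtain ⟨J₀, hJ₀⟩ := exists_forall_not_annihilatorIdeal_le_iff I M (topPrimes I M d)
  have hfin := finite_image_topPrimes (I := I) hd
  obtain ⟨m, x, f, hm, hfx, hfJ, hfQ⟩ := reesAlgebra.exists_homogeneous_forall_notMem
    hfin.toFinset (𝔠 := annihilatorIdeal I M J₀)
    (by
      intro Q hQ
      obtain ⟨Q, -, rfl⟩ := hfin.mem_toFinset.mp hQ
      exact Q.2)
    (by
      intro P hP Q hQ hle
      obtain ⟨P, hPT, rfl⟩ := hfin.mem_toFinset.mp hP
      obtain ⟨Q, hQT, rfl⟩ := hfin.mem_toFinset.mp hQ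
      exact eq_of_mem_topPrimes_of_le hd hQT hPT.1 hle)
    (by
      intro Q hQ
      obtain ⟨Q, hQT, rfl⟩ := hfin.mem_toFinset.mp hQ
      exact component_mem_of_hasPrimeChain hd hQT.1 hQT.2)
    (by
      intro Q hQ
      obtain ⟨Q, hQT, rfl⟩ := hfin.mem_toFinset.mp hQ
      exact exists_component_notMem_of_mem_topPrimes hd hdim hQT)
    (fun f hf n => component_mem_annihilatorIdeal hf n)
    (by
      intro Q hQ
      obtain ⟨Q, hQT, rfl⟩ := hfin.mem_toFinset.mp hQ
      exact (hJ₀ J₀).mpr le_rfl Q hQT)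
  have hx : x ∈ I ^ m := by
    have := f.2 m
    rwa [hfx, Polynomial.coeff_monomial, if_pos rfl] at this
  obtain rfl : f = ⟨Polynomial.monomial m x, reesAlgebra.monomial_mem.mpr hx⟩ := Subtype.ext hfx
  have hxQ : ∀ Q ∈ topPrimes I M d,
      (⟨Polynomial.monomial m x, reesAlgebra.monomial_mem.mpr hx⟩ : reesAlgebra I) ∉ Q.asIdeal :=
    fun Q hQ => hfQ _ (hfin.mem_toFinset.mpr ⟨Q, hQ, rfl⟩)
  have hxI : x ∉ I ^ (m + 1) := by
    intro hx'
    obtain ⟨Q, hQ⟩ := topPrimes_nonempty (M := M) hI hd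
    -- If `x ∈ Iᵐ⁺¹`, then `x tᵐ` annihilates `G_I(M)` and lies in every top prime, of which there
    -- is at least one.
    refine hxQ Q hQ (hQ.1 fun n z _ => ?_)
    rw [Polynomial.coeff_monomial]
    split_ifs with h
    · exact h ▸ Submodule.smul_mem_smul hx' Submodule.mem_top
    · rw [zero_smul]
      exact Submodule.zero_mem _
  have hcolon : ∀ (n : ℕ) (a : A) (ha : a ∈ I ^ n), (∀ Q ∈ topPrimes I M d,
      (⟨Polynomial.monomial n a, reesAlgebra.monomial_mem.mpr ha⟩ : reesAlgebra I) ∉ Q.asIdeal) →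
      (I ^ (n + 1) • ⊤ : Submodule A M).colon
        ((Ideal.span {a} • ⊤ : Submodule A M) : Set M) ≤ J₀ := by
    intro n a ha h
    exact (hJ₀ _).mp fun Q hQ hle => h Q hQ
      (hle ((monomial_mem_annihilatorIdeal ha).mpr le_rfl))
  have hxJ : (I ^ (m + 1) • ⊤ : Submodule A M).colon
      ((Ideal.span {x} • ⊤ : Submodule A M) : Set M) = J₀ :=
    le_antisymm (hcolon m x hx hxQ) ((monomial_mem_annihilatorIdeal hx).mp hfJ)
  have hsop := (isPartOfSystemOfParametersGraded_iff hI hd hm hx).mpr hxQ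
  have hfirst : firstCoefficientIdeal I M = (J₀ : Set A) := by
    refine Set.Subset.antisymm ?_ fun r hr => ⟨m, x, hx, hm, hxI, hsop, hxJ ▸ hr⟩
    rintro r ⟨n, a, ha, hn, -, hpart, hr⟩
    exact hcolon n a ha ((isPartOfSystemOfParametersGraded_iff hI hd hn ha).mp hpart) hr
  refine ⟨⟨m, x, hx, hm, hxI, hsop, by rw [hfirst, hxJ]⟩,
    (supportDim_assocGradedModule hI hd).trans hd.symm, fun J _ => ?_⟩
  rw [hfirst, hd, supportDim_gradedSubmoduleOfIdeal_lt_iff hd, hJ₀]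
  exact SetLike.coe_subset_coe

end
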